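/- **Theorem.** Let $\Lambda$ be a left and right noetherian ring and let $n,k\ge 0$ be integers. Write $\operatorname{mod}\Lambda$ for the category of finitely generated left $\Lambda$-modules. For a left (or right) $\Lambda$-module $X$ regard $\operatorname{Ext}^i_\Lambda(X,\Lambda)$ as a right (or left) $\Lambda$-module, and let $\operatorname{grade}X=\inf\{i\ge 0: \operatorname{Ext}^i_\Lambda(X,\Lambda)\ne 0\}$ and $\operatorname{rgrade}X=\inf\{i>0: \operatorname{Ext}^i_\Lambda(X,\Lambda)\ne 0\}$, with $\inf\emptyset=\infty$. For $m\ge 0$ let - $\mathcal W_m=\{C\in\operatorname{mod}\Lambda : \operatorname{rgrade}C>m\}$; - $\mathcal P_m=\{C\in\operatorname{mod}\Lambda : \operatorname{pd}C<m\}$, where $\operatorname{pd}0=-\infty$; - $\mathcal F_m$ be the class of $m$-torsionfree modules, i.e. of the $C\in\operatorname{mod}\Lambda$ with $\operatorname{Ext}^i_\Lambda(\operatorname{Tr}C,\Lambda)=0$ for $1\le i\le m$; here $\operatorname{Tr}C=\operatorname{Coker}(P_0^*\to P_1^*)$ with $(-)^*=\operatorname{Hom}_\Lambda(-,\Lambda)$,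 for an exact sequence $P_1\to P_0\to C\to 0$ with $P_0,P_1$ finitely generated projective (the condition does not depend on its choice); - $\Omega^m C$ denote any $m$-th syzygy of $C\in\operatorname{mod}\Lambda$, i.e. any module in an exact sequence $0\to\Omega^mC\to P_{m-1}\to\cdots\to P_0\to C\to 0$ with all $P_j$ finitely generated projective (so $\Omega^0C\cong C$), and let $\Omega^m(\operatorname{mod}\Lambda)$ be the class of all $m$-th syzygies of modules in $\operatorname{mod}\Lambda$. Consider the following conditions. 1. $\Lambda$ is $g_n(k)$: $\operatorname{grade}\operatorname{Ext}^{i+k}_\Lambda(C,\Lambda)\ge i$ for all $C\in\operatorname{mod}\Lambda$ and $1\le i\le n$. 2. For every monomorphism $f:A\to B$ with $A,B\in\Omega^{k+1}(\operatorname{mod}\Lambda)$, the map $\operatorname{Ext}^i_\Lambda(\operatorname{Ext}^i_\Lambda(f,\Lambda),\Lambda)$ is a monomorphism for all $0\le i<n$. 3. $\Omega^{i+k}(\operatorname{mod}\Lambda)\subseteq\mathcal F_{i+1}$ for all $1\le i\le n$. 4. For all $C\in\operatorname{mod}\Lambda$, $0\le i\le n$ and every $\Omega^{k-1}C$, there is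 an exact sequence $0\to Y\to X\to\Omega^{k-1}C\to 0$ with $X\in\mathcal W_{i+1}$ and $Y\in\mathcal P_{i+1}$. 5. For all $C\in\operatorname{mod}\Lambda$, $0\le i\le n$ and every $\Omega^kC$, there is an exact sequence $0\to\Omega^kC\to Y'\to X'\to 0$ with $X'\in\mathcal W_{i+1}$ and $Y'\in\mathcal P_{i+1}$. Then (1) and (2) are equivalent. If $k>0$, then (1)–(5) are equivalent. -/

import Mathlib

open CategoryTheory CategoryTheory.Abelian MulOpposite

universe u

namespace AuslanderType

/-! For a ring `R`, left `R`-modules are objects of `ModuleCat R`, and right `R`-modules are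
objects of `ModuleCat Rᵐᵒᵖ`. -/

section Ext

variable {R : Type u} [Ring R]

/-- The `R`-linear endomorphism `x ↦ x * r` of the left `R`-module `R`. -/
def rightMul (r : R) : ModuleCat.of R R ⟶ ModuleCat.of R R :=
  ModuleCat.ofHom (LinearMap.toSpanSingleton R R r)

/-- `Extⁿ_R(X, R)` is a right `R`-module: `r` acts through the functoriality of `Ext` in the
second variable, applied to the endomorphism `x ↦ x * r` of the left module `R`. -/
noncomputable instance extRightModule (X : ModuleCat.{u} R) (n : ℕ) :
    Module Rᵐᵒᵖ (Ext X (ModuleCat.of R R) n) where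
  smul r e := e.comp (Ext.mk₀ (rightMul r.unop)) (add_zero n)
  one_smul e := by
    have h : rightMul (1 : R) = 𝟙 _ := by
      ext; simp [rightMul]
    change e.comp (Ext.mk₀ (rightMul (1 : R))) (add_zero n) = e
    rw [h, Ext.comp_mk₀_id]
  mul_smul r s e := by
    change e.comp (Ext.mk₀ (rightMul (s.unop * r.unop))) (add_zero n) =
      (e.comp (Ext.mk₀ (rightMul s.unop)) (add_zero n)).comp
        (Ext.mk₀ (rightMul r.unop)) (add_zero n)
    have h : rightMul (s.unop * r.unop) = rightMul s.unop ≫ rightMul r.unop := by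
      ext; simp [rightMul]
    rw [Ext.comp_assoc_of_third_deg_zero, Ext.mk₀_comp_mk₀, h]
  smul_zero r := by
    change (0 : Ext X (ModuleCat.of R R) n).comp (Ext.mk₀ (rightMul r.unop)) (add_zero n) = 0
    rw [Ext.zero_comp]
  smul_add r e e' := Ext.add_comp _ _ _ _
  add_smul r s e := by
    change e.comp (Ext.mk₀ (rightMul (r.unop + s.unop))) (add_zero n) =
      e.comp (Ext.mk₀ (rightMul r.unop)) (add_zero n) +
        e.comp (Ext.mk₀ (rightMul s.unop)) (add_zero n)
    have h : rightMul (r.unop + s.unop) = rightMul r.unop + rightMul s.unop := by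
      ext; simp [rightMul]
    rw [h, Ext.mk₀_add, Ext.comp_add]
  zero_smul e := by
    change e.comp (Ext.mk₀ (rightMul (0 : R))) (add_zero n) = 0
    have h : rightMul (0 : R) = 0 := by
      ext; simp [rightMul]
    rw [h, Ext.mk₀_zero, Ext.comp_zero]

/-- The right `R`-module `Extⁿ_R(X, R)`. -/
noncomputable def extDual (n : ℕ) (X : ModuleCat.{u} R) : ModuleCat.{u} Rᵐᵒᵖ :=
  ModuleCat.of Rᵐᵒᵖ (Ext X (ModuleCat.of R R) n)

/-- The homomorphism `Extⁿ_R(f, R) : Extⁿ_R(Y, R) → Extⁿ_R(X, R)` of right `R`-modules that is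
induced by `f : X ⟶ Y`. -/
noncomputable def extDualMap (n : ℕ) {X Y : ModuleCat.{u} R} (f : X ⟶ Y) :
    extDual n Y ⟶ extDual n X :=
  ModuleCat.ofHom (X := Ext Y (ModuleCat.of R R) n) (Y := Ext X (ModuleCat.of R R) n)
    { toFun := fun e => (Ext.mk₀ f).comp e (zero_add n)
      map_add' := fun e e' => Ext.comp_add _ _ _ _
      map_smul' := fun r e => by
        change (Ext.mk₀ f).comp (e.comp (Ext.mk₀ (rightMul r.unop)) (add_zero n)) (zero_add n) =
          ((Ext.mk₀ f).comp e (zero_add n)).comp (Ext.mk₀ (rightMul r.unop)) (add_zero n)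
        rw [Ext.comp_assoc_of_third_deg_zero] }

/-- The grade of `X`: the infimum of all `i ≥ 0` with `Extⁱ_R(X, R) ≠ 0` (and `⊤` if there is
no such `i`). -/
noncomputable def grade (X : ModuleCat.{u} R) : ℕ∞ :=
  sInf {m : ℕ∞ | ∃ i : ℕ, m = i ∧ Nontrivial (extDual i X)}

/-- The reduced grade of `X`: the infimum of all `i > 0` with `Extⁱ_R(X, R) ≠ 0` (and `⊤` if there
is no such `i`). -/
noncomputable def rgrade (X : ModuleCat.{u} R) : ℕ∞ :=
  sInf {m : ℕ∞ | ∃ i : ℕ, 0 < i ∧ m = i ∧ Nontrivial (extDual i X)}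

end Ext

section Modules

variable {R : Type u} [Ring R]

/-- `0 → X → Y → Z → 0` is exact. -/
def IsShortExact {X Y Z : ModuleCat.{u} R} (f : X ⟶ Y) (g : Y ⟶ Z) : Prop :=
  ∃ w : f ≫ g = 0, (ShortComplex.mk f g w).ShortExact

/-- `S` is an `n`-th syzygy `Ωⁿ C` of `C`: there is an exact sequence
`0 → S → P_{n-1} → ⋯ → P_0 → C → 0` with all `P_j` finitely generated projective. It is cut into
short exact sequences here; for `n = 0` it says `S ≅ C`. -/
def IsSyzygy : ℕ → ModuleCat.{u} R → ModuleCat.{u} R → Prop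
  | 0, C, S => Nonempty (S ≅ C)
  | n + 1, C, S => ∃ (K P : ModuleCat.{u} R) (f : K ⟶ P) (g : P ⟶ C),
      Module.Finite R P ∧ Module.Projective R P ∧ IsShortExact f g ∧ IsSyzygy n K S

/-- The homomorphism `f* : N* → M*` of right `R`-modules, `φ ↦ φ ∘ f`, where
`M* = Hom_R(M, R)`. -/
def dualMap {M N : Type u} [AddCommGroup M] [Module R M] [AddCommGroup N] [Module R N]
    (f : M →ₗ[R] N) : (N →ₗ[R] R) →ₗ[Rᵐᵒᵖ] (M →ₗ[R] R) where
  toFun φ := φ.comp f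
  map_add' _ _ := rfl
  map_smul' _ _ := rfl

/-- `T` is a transpose `Tr C` of `C`: there is an exact sequence `P₁ → P₀ → C → 0` with `P₁`, `P₀`
finitely generated projective, such that `T` is isomorphic to the cokernel of `P₀* → P₁*`.
Any two transposes of `C` become isomorphic after adding finitely generated projective
right modules to both of them. -/
def IsTranspose (C : ModuleCat.{u} R) (T : ModuleCat.{u} Rᵐᵒᵖ) : Prop :=
  ∃ (P₁ P₀ : ModuleCat.{u} R) (d : P₁ ⟶ P₀) (p : P₀ ⟶ C),
    Module.Finite R P₁ ∧ Module.Projective R P₁ ∧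
    Module.Finite R P₀ ∧ Module.Projective R P₀ ∧
    Function.Exact d.hom p.hom ∧ Function.Surjective p.hom ∧
    Nonempty (T ≃ₗ[Rᵐᵒᵖ] ((P₁ →ₗ[R] R) ⧸ LinearMap.range (dualMap d.hom)))

/-- Over a left noetherian ring, every finitely generated module has a transpose. -/
theorem exists_isTranspose [IsNoetherianRing R] (C : ModuleCat.{u} R) [Module.Finite R C] :
    ∃ T, IsTranspose C T := by
  obtain ⟨n, p, hp⟩ := Module.Finite.exists_fin' R C
  obtain ⟨m, q, hq⟩ := Module.Finite.exists_fin' R (LinearMap.ker p)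
  refine ⟨ModuleCat.of Rᵐᵒᵖ (((Fin m → R) →ₗ[R] R) ⧸
      LinearMap.range (dualMap ((LinearMap.ker p).subtype ∘ₗ q))),
    ModuleCat.of R (Fin m → R), ModuleCat.of R (Fin n → R),
    ModuleCat.ofHom ((LinearMap.ker p).subtype ∘ₗ q), ModuleCat.ofHom p,
    inferInstanceAs (Module.Finite R (Fin m → R)),
    inferInstanceAs (Module.Projective R (Fin m → R)),
    inferInstanceAs (Module.Finite R (Fin n → R)),
    inferInstanceAs (Module.Projective R (Fin n → R)), ?_, hp, ⟨LinearEquiv.refl _ _⟩⟩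
  rw [LinearMap.exact_iff]
  change LinearMap.ker p = LinearMap.range ((LinearMap.ker p).subtype ∘ₗ q)
  rw [LinearMap.range_comp, LinearMap.range_eq_top.mpr hq, Submodule.map_top,
    Submodule.range_subtype]

variable (R)

/-- `Ωⁿ(mod R)`: the modules `S` for which there is an exact sequence
`0 → S → P_{n-1} → ⋯ → P_0` of finitely generated modules with all `P_j` projective, that is, the
`n`-th syzygies of finitely generated modules. -/
def Omega (n : ℕ) : ObjectProperty (ModuleCat.{u} R) := fun S =>
  ∃ C : ModuleCat.{u} R, Module.Finite R C ∧ IsSyzygy n C S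

/-- `𝒲ₙ`: the finitely generated modules of reduced grade `> n`. -/
def W (n : ℕ) : ObjectProperty (ModuleCat.{u} R) := fun C =>
  Module.Finite R C ∧ (n : ℕ∞) < rgrade C

/-- `ℱₙ`: the finitely generated `n`-torsionfree modules, where `C` is `n`-torsionfree if
`Extⁱ(Tr C, R) = 0` for all `1 ≤ i ≤ n`. -/
def F (n : ℕ) : ObjectProperty (ModuleCat.{u} R) := fun C =>
  Module.Finite R C ∧ ∀ T : ModuleCat.{u} Rᵐᵒᵖ, IsTranspose C T →
    ∀ i : ℕ, 1 ≤ i → i ≤ n → Subsingleton (extDual i T)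

/-- `𝒫ₙ`: the finitely generated modules of projective dimension `< n`. -/
def P (n : ℕ) : ObjectProperty (ModuleCat.{u} R) := fun C =>
  Module.Finite R C ∧ projectiveDimension C < (n : WithBot ℕ∞)

/-- `R` is `gₙ(k)`: `grade Ext^{i+k}_R(C, R) ≥ i` for all finitely generated left modules `C` and
all `1 ≤ i ≤ n`. The grade is that of a right module. -/
def IsSmallG (n k : ℕ) : Prop :=
  ∀ C : ModuleCat.{u} R, Module.Finite R C → ∀ i : ℕ, 1 ≤ i → i ≤ n →
    (i : ℕ∞) ≤ grade (extDual (i + k) C)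

end Modules

end AuslanderType

/-!
Write `Eⁱ(X) = Extⁱ(X, Λ)` and `X* = Hom(X, Λ)`.

The equivalence of the grade condition with the condition on monomorphisms rests on the dimension
shift `Eⁱ(Ωᵏ⁺¹ C) ≅ Eⁱ⁺ᵏ⁺¹(C)` for `i ≥ 1`. It shows that for `i ≥ 1` the source of `Eⁱ(Eⁱ(f))`
vanishes under `gₙ(k)`, so that only `f**` needs an argument; conversely, for an embedding
`A → P` of `A = Ωᵏ⁺¹ C` into a projective module, injectivity of `Eⁱ(Eⁱ(A)) → Eⁱ(Eⁱ(P))` says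
exactly that `Eⁱ(Eⁱ⁺ᵏ⁺¹(C)) = 0`, and these vanishing statements, for all `C`, make up `gₙ(k)`.

For `k > 0`, the remaining conditions are reached by a cycle: the grade condition implies
torsionfreeness of syzygies, which yields approximations of `Ωᵏ⁻¹ C`, which yield embeddings of
`Ωᵏ C`, which imply the grade condition. The main tool is the exact sequence
`0 → E¹(M') → T' → P₁* → T → 0` that links transposes `T` of `M` and `T'` of `M'` when
`0 → M → Q → M' → 0` is exact with `Q` finitely generated projective
(`IsTranspose.exists_of_isShortExact`), together with the fact that `E¹(T) = 0` if and only if `M`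
is torsionless (`IsTranspose.subsingleton_extDual_one_iff`).

* If `grade Eʲ⁺¹(C) ≥ j` for `j < m`, the sequence shows by induction that `Ωᵐ C` is
  `m`-torsionfree (`IsSyzygy.subsingleton_extDual_transpose`). Applied to `Ωᵏ⁻¹ C`, this gives
  torsionfreeness.
* A torsionfree module `Ωⁱ⁺¹ S` can be embedded repeatedly into projective modules such that
  homomorphisms to `Λ` extend. Comparing these embeddings with a projective resolution of `S`
  turns the trivial approximation of `Ωⁱ⁺¹ S` step by step into one of `S`
  (`exists_approximation`).
* An approximation of `Ωᵏ⁻¹ C`, pulled back along an epimorphism from a projective module with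
  kernel `Ωᵏ C`, becomes an embedding of `Ωᵏ C` (`exists_pullback_sequence`).
* Such an embedding `Ωᵏ C → Y` gives `Eʲ⁺ᵏ(C) ≅ Eʲ(Y)` for `1 ≤ j ≤ i`, where `pd Y ≤ i`. By
  induction on `i` and the first item, `Ωⁱ⁻¹ Y` is `(i - 1)`-torsionfree. As `Eⁱ(Y)` is a transpose
  of `Ωⁱ⁻¹ Y`, its grade is at least `i` (`le_grade_extDual_of_hasProjectiveDimensionLT`).
-/

namespace AuslanderType

/-! ### The long exact sequence of `Ext(-, R)` as right modules -/

section ExactSequences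

variable {R : Type u} [Ring R]

theorem isShortExact_iff {X Y Z : ModuleCat.{u} R} {f : X ⟶ Y} {g : Y ⟶ Z} :
    IsShortExact f g ↔ Function.Injective f.hom ∧ Function.Exact f.hom g.hom ∧
      Function.Surjective g.hom := by
  constructor
  · rintro ⟨w, h⟩
    exact ⟨h.moduleCat_injective_f,
      (ShortComplex.ShortExact.moduleCat_exact_iff_function_exact _).1 h.exact,
      h.moduleCat_surjective_g⟩
  · rintro ⟨h₁, h₂, h₃⟩
    refine ⟨?_, ModuleCat.shortComplex_shortExact _ h₂ h₁ h₃⟩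
    ext x
    exact h₂.apply_apply_eq_zero x

theorem IsShortExact.of_linearMap {X Y Z : Type u} [AddCommGroup X] [Module R X] [AddCommGroup Y]
    [Module R Y] [AddCommGroup Z] [Module R Z] {f : X →ₗ[R] Y} {g : Y →ₗ[R] Z}
    (h₁ : Function.Injective f) (h₂ : Function.Exact f g) (h₃ : Function.Surjective g) :
    IsShortExact (ModuleCat.ofHom f) (ModuleCat.ofHom g) :=
  isShortExact_iff.2 ⟨h₁, h₂, h₃⟩

section

variable {X Y Z : ModuleCat.{u} R} {f : X ⟶ Y} {g : Y ⟶ Z}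

theorem IsShortExact.injective (h : IsShortExact f g) : Function.Injective f.hom :=
  (isShortExact_iff.1 h).1

theorem IsShortExact.exact (h : IsShortExact f g) : Function.Exact f.hom g.hom :=
  (isShortExact_iff.1 h).2.1

theorem IsShortExact.surjective (h : IsShortExact f g) : Function.Surjective g.hom :=
  (isShortExact_iff.1 h).2.2

/-- The connecting homomorphism `Extⁿ(X, R) → Extⁿ⁺¹(Z, R)` of a short exact sequence
`0 → X → Y → Z → 0`, as a homomorphism of right modules. -/
noncomputable def connecting (h : IsShortExact f g) (n : ℕ) :
    extDual n X ⟶ extDual (n + 1) Z :=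
  ModuleCat.ofHom (X := Ext X (ModuleCat.of R R) n) (Y := Ext Z (ModuleCat.of R R) (n + 1))
    { toFun := fun e => h.choose_spec.extClass.comp e (add_comm 1 n)
      map_add' := fun e e' => Ext.comp_add _ _ _ _
      map_smul' := fun r e => by
        change h.choose_spec.extClass.comp
            (e.comp (Ext.mk₀ (rightMul r.unop)) (add_zero n)) (add_comm 1 n) =
          (h.choose_spec.extClass.comp e (add_comm 1 n)).comp
            (Ext.mk₀ (rightMul r.unop)) (add_zero (n + 1))
        rw [Ext.comp_assoc_of_third_deg_zero] }

theorem extDualMap_comp {W : ModuleCat.{u} R} (n : ℕ) (a : X ⟶ Y) (b : Y ⟶ W) :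
    extDualMap n (a ≫ b) = extDualMap n b ≫ extDualMap n a := by
  ext e
  exact (Ext.mk₀_comp_mk₀_assoc (n := n) a b e).symm

theorem extDualMap_id (n : ℕ) : extDualMap n (𝟙 X) = 𝟙 _ := by
  ext e
  exact Ext.mk₀_id_comp (n := n) e

theorem extDualMap_zero (n : ℕ) : extDualMap n (0 : X ⟶ Y) = 0 := by
  have h (e : Ext Y (ModuleCat.of R R) n) :
      (Ext.mk₀ (0 : X ⟶ Y)).comp e (zero_add n) = 0 := by
    rw [Ext.mk₀_zero, Ext.zero_comp]
  ext e
  exact h e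

/-- `Extⁿ(-, R)` takes isomorphisms to isomorphisms. -/
noncomputable def extDualIso (n : ℕ) (e : X ≅ Y) : extDual n X ≅ extDual n Y where
  hom := extDualMap n e.inv
  inv := extDualMap n e.hom
  hom_inv_id := by rw [← extDualMap_comp, e.hom_inv_id, extDualMap_id]
  inv_hom_id := by rw [← extDualMap_comp, e.inv_hom_id, extDualMap_id]

theorem subsingleton_of_iso (e : X ≅ Y) [Subsingleton X] : Subsingleton Y :=
  e.toLinearEquiv.symm.injective.subsingleton

theorem subsingleton_extDual_of_iso {n : ℕ} (e : X ≅ Y) (h : Subsingleton (extDual n X)) :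
    Subsingleton (extDual n Y) :=
  subsingleton_of_iso (extDualIso n e)

theorem exact_extDualMap (h : IsShortExact f g) (n : ℕ) :
    Function.Exact (extDualMap n g).hom (extDualMap n f).hom := by
  obtain ⟨w, hs⟩ := id h
  refine fun e => ⟨fun he => Ext.contravariant_sequence_exact₂ (n := n) hs _ e he, ?_⟩
  rintro ⟨e, rfl⟩
  have : extDualMap n f (extDualMap n g e) = extDualMap n (f ≫ g) e := by
    rw [extDualMap_comp]; rfl
  refine this.trans ?_
  rw [w, extDualMap_zero]
  rfl

theorem exact_extDualMap_connecting (h : IsShortExact f g) (n : ℕ) :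
    Function.Exact (extDualMap n f).hom (connecting h n).hom := by
  refine fun e => ⟨fun he => ?_, ?_⟩
  · exact Ext.contravariant_sequence_exact₁ h.choose_spec _ (n₀ := n) e (add_comm 1 n) he
  · rintro ⟨e, rfl⟩
    exact h.choose_spec.extClass_comp_assoc (n := n) e (h := add_comm 1 n)

theorem exact_connecting_extDualMap (h : IsShortExact f g) (n : ℕ) :
    Function.Exact (connecting h n).hom (extDualMap (n + 1) g).hom := by
  refine fun e => ⟨fun he => ?_, ?_⟩
  · exact Ext.contravariant_sequence_exact₃ h.choose_spec _ (n₁ := n + 1) e he (add_comm 1 n)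
  · rintro ⟨e, rfl⟩
    exact h.choose_spec.comp_extClass_assoc (n := n) e (add_comm 1 n)

/-- Vanishing at the middle term of a short exact sequence. -/
theorem subsingleton_extDual_middle (h : IsShortExact f g) {n : ℕ}
    (hX : Subsingleton (extDual n X)) (hZ : Subsingleton (extDual n Z)) :
    Subsingleton (extDual n Y) := by
  refine subsingleton_of_forall_eq 0 fun e => ?_
  obtain ⟨e, rfl⟩ := (exact_extDualMap h n e).1 (Subsingleton.elim _ _)
  rw [Subsingleton.elim e 0, map_zero]

theorem subsingleton_extDual_left (h : IsShortExact f g) {n : ℕ}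
    (hY : Subsingleton (extDual n Y)) (hZ : Subsingleton (extDual (n + 1) Z)) :
    Subsingleton (extDual n X) := by
  refine subsingleton_of_forall_eq 0 fun e => ?_
  obtain ⟨e, rfl⟩ := (exact_extDualMap_connecting h n e).1 (Subsingleton.elim _ _)
  rw [Subsingleton.elim e 0, map_zero]

theorem subsingleton_extDual_right (h : IsShortExact f g) {n : ℕ}
    (hX : Subsingleton (extDual n X)) (hY : Subsingleton (extDual (n + 1) Y)) :
    Subsingleton (extDual (n + 1) Z) := by
  refine subsingleton_of_forall_eq 0 fun e => ?_
  obtain ⟨e, rfl⟩ := (exact_connecting_extDualMap h n e).1 (Subsingleton.elim _ _)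
  rw [Subsingleton.elim e 0, map_zero]

theorem surjective_connecting (h : IsShortExact f g) {n : ℕ}
    (hY : Subsingleton (extDual (n + 1) Y)) : Function.Surjective (connecting h n).hom :=
  fun e => (exact_connecting_extDualMap h n e).1 (Subsingleton.elim _ _)

/-- Dimension shift: `Extⁿ(X, R) ≅ Extⁿ⁺¹(Z, R)` as right modules if `Ext(Y, R)` vanishes in
degrees `n` and `n + 1`. -/
theorem nonempty_iso_of_vanishing (h : IsShortExact f g) {n : ℕ}
    (hY : Subsingleton (extDual n Y)) (hY' : Subsingleton (extDual (n + 1) Y)) :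
    Nonempty (extDual n X ≅ extDual (n + 1) Z) := by
  refine ⟨(LinearEquiv.ofBijective (connecting h n).hom
    ⟨?_, surjective_connecting h hY'⟩).toModuleIso⟩
  rw [injective_iff_map_eq_zero]
  intro e he
  obtain ⟨e, rfl⟩ := (exact_extDualMap_connecting h n e).1 he
  rw [Subsingleton.elim e 0, map_zero]

/-- `Extⁿ(Y, R) ≅ Extⁿ(X, R)` as right modules if `Ext(Z, R)` vanishes in degrees `n` and
`n + 1`. -/
theorem nonempty_iso_of_vanishing_right (h : IsShortExact f g) {n : ℕ}
    (hZ : Subsingleton (extDual n Z)) (hZ' : Subsingleton (extDual (n + 1) Z)) :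
    Nonempty (extDual n Y ≅ extDual n X) := by
  refine ⟨(LinearEquiv.ofBijective (extDualMap n f).hom ⟨?_, ?_⟩).toModuleIso⟩
  · rw [injective_iff_map_eq_zero]
    intro e he
    obtain ⟨e, rfl⟩ := (exact_extDualMap h n e).1 he
    rw [Subsingleton.elim e 0, map_zero]
  · exact fun e => (exact_extDualMap_connecting h n e).1 (Subsingleton.elim _ _)

end

theorem subsingleton_extDual_of_projective (P : ModuleCat.{u} R) [Module.Projective R P]
    {n : ℕ} (hn : 1 ≤ n) : Subsingleton (extDual n P) := by
  obtain ⟨n, rfl⟩ := Nat.exists_eq_add_of_le' hn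
  have : Projective P := (IsProjective.iff_projective P).1 inferInstance
  exact Ext.subsingleton_of_projective P (ModuleCat.of R R) n

theorem subsingleton_extDual_of_subsingleton (X : ModuleCat.{u} R) [Subsingleton X] (n : ℕ) :
    Subsingleton (extDual n X) := by
  refine subsingleton_of_forall_eq 0 fun e => ?_
  have h : (𝟙 X : X ⟶ X) = 0 := by ext x; exact Subsingleton.elim _ _
  have h' : extDualMap n (𝟙 X) e = e := by rw [extDualMap_id]; rfl
  rw [← h', h, extDualMap_zero]
  rfl

/-- `Ext⁰(X, R)` is the dual `Hom(X, R)`, as a right module. -/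
noncomputable def dualEquiv (X : ModuleCat.{u} R) : (X →ₗ[R] R) ≃ₗ[Rᵐᵒᵖ] extDual 0 X where
  toFun φ := (Ext.mk₀ (Y := ModuleCat.of R R) (ModuleCat.ofHom φ) :)
  invFun e := (Ext.addEquiv₀ (Y := ModuleCat.of R R) e).hom
  map_add' φ ψ := Ext.mk₀_add (Y := ModuleCat.of R R) (ModuleCat.ofHom φ) (ModuleCat.ofHom ψ)
  map_smul' r φ := by
    change Ext.mk₀ (Y := ModuleCat.of R R) (ModuleCat.ofHom (r • φ)) =
      (Ext.mk₀ (Y := ModuleCat.of R R) (ModuleCat.ofHom φ)).comp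
        (Ext.mk₀ (rightMul r.unop)) (add_zero 0)
    rw [Ext.mk₀_comp_mk₀]
    congr 1
  left_inv φ := by
    exact congrArg ModuleCat.Hom.hom
      (Ext.addEquiv₀.apply_symm_apply (ModuleCat.ofHom φ : X ⟶ ModuleCat.of R R))
  right_inv e := Ext.mk₀_addEquiv₀_apply (Y := ModuleCat.of R R) e

theorem extDualMap_dualEquiv {X Y : ModuleCat.{u} R} (f : X ⟶ Y) (φ : Y →ₗ[R] R) :
    extDualMap 0 f (dualEquiv Y φ) = dualEquiv X (dualMap f.hom φ) :=
  Ext.mk₀_comp_mk₀ (Z := ModuleCat.of R R) f (ModuleCat.ofHom φ)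

theorem subsingleton_extDual_zero_iff {X : ModuleCat.{u} R} :
    Subsingleton (extDual 0 X) ↔ ∀ φ : X →ₗ[R] R, φ = 0 :=
  (dualEquiv X).toEquiv.subsingleton_congr.symm.trans
    ⟨fun _ _ => Subsingleton.elim _ _, fun h => subsingleton_of_forall_eq 0 h⟩

end ExactSequences

/-! ### Duality for finitely generated projective modules -/

section Duality

variable {R : Type u} [Ring R]

/-- Evaluation at `x ∈ M`, as a homomorphism of right modules `Hom(M, R) → R`. -/
def evalDual {M : Type u} [AddCommGroup M] [Module R M] (x : M) :
    (M →ₗ[R] R) →ₗ[Rᵐᵒᵖ] Rᵐᵒᵖ where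
  toFun φ := op (φ x)
  map_add' _ _ := rfl
  map_smul' _ _ := rfl

/-- `M` is torsionless: the elements of `Hom(M, R)` separate the points of `M`. -/
def IsTorsionless (R : Type u) [Ring R] (M : Type u) [AddCommGroup M] [Module R M] : Prop :=
  ∀ x : M, (∀ φ : M →ₗ[R] R, φ x = 0) → x = 0

theorem IsTorsionless.of_injective {M N : Type u} [AddCommGroup M] [Module R M] [AddCommGroup N]
    [Module R N] (hN : IsTorsionless R N) (f : M →ₗ[R] N) (hf : Function.Injective f) :
    IsTorsionless R M := fun x hx => by
  refine hf ?_
  rw [map_zero]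
  exact hN _ fun φ => hx (φ.comp f)

section

variable (R) (P : Type u) [AddCommGroup P] [Module R P] [Module.Finite R P]
  [Module.Projective R P]

/-- A finitely generated projective module has a finite dual basis. -/
theorem exists_dual_basis :
    ∃ (n : ℕ) (e : Fin n → P) (c : Fin n → (P →ₗ[R] R)), ∀ p, ∑ i, c i p • e i = p := by
  obtain ⟨n, f, g, -, -, h⟩ := Module.Finite.exists_comp_eq_id_of_projective R P
  refine ⟨n, fun i => f (Pi.single i 1), fun i => (LinearMap.proj i).comp g, fun p => ?_⟩
  have h' : f (g p) = p := LinearMap.congr_fun h p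
  conv_rhs => rw [← h', pi_eq_sum_univ' (g p), map_sum]
  refine Finset.sum_congr rfl fun i _ => ?_
  rw [← map_smul]
  rfl

theorem exists_dual_retract : ∃ (n : ℕ) (i : (P →ₗ[R] R) →ₗ[Rᵐᵒᵖ] (Fin n → Rᵐᵒᵖ))
    (s : (Fin n → Rᵐᵒᵖ) →ₗ[Rᵐᵒᵖ] (P →ₗ[R] R)), s.comp i = LinearMap.id := by
  obtain ⟨n, e, c, h⟩ := exists_dual_basis R P
  refine ⟨n, LinearMap.pi fun i => evalDual (e i), Fintype.linearCombination Rᵐᵒᵖ c, ?_⟩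
  ext φ p
  conv_rhs => rw [LinearMap.id_apply, ← h p, map_sum]
  simp [Fintype.linearCombination_apply, evalDual]

theorem projective_dual : Module.Projective Rᵐᵒᵖ (P →ₗ[R] R) := by
  obtain ⟨n, i, s, h⟩ := exists_dual_retract R P
  exact Module.Projective.of_split i s h

theorem finite_dual : Module.Finite Rᵐᵒᵖ (P →ₗ[R] R) := by
  obtain ⟨n, i, s, h⟩ := exists_dual_retract R P
  exact Module.Finite.of_surjective s fun x => ⟨i x, LinearMap.congr_fun h x⟩

theorem isTorsionless_of_projective : IsTorsionless R P := fun p hp => by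
  obtain ⟨n, e, c, h⟩ := exists_dual_basis R P
  rw [← h p]
  exact Finset.sum_eq_zero fun i _ => by rw [hp, zero_smul]

variable {P}

/-- Finitely generated projective modules are reflexive. -/
theorem exists_eq_evalDual (ψ : (P →ₗ[R] R) →ₗ[Rᵐᵒᵖ] Rᵐᵒᵖ) : ∃ p : P, ψ = evalDual p := by
  obtain ⟨n, e, c, h⟩ := exists_dual_basis R P
  refine ⟨∑ i, unop (ψ (c i)) • e i, LinearMap.ext fun φ => ?_⟩
  have hφ : φ = ∑ i, op (φ (e i)) • c i := by
    ext p
    conv_lhs => rw [← h p, map_sum]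
    simp
  conv_lhs => rw [hφ, map_sum]
  apply unop_injective
  simp [evalDual]

end

end Duality

/-! ### Transposes and torsionless modules -/

section Transpose

variable {R : Type u} [Ring R]

theorem isShortExact_subtype_mkQ {M : Type u} [AddCommGroup M] [Module R M] (N : Submodule R M) :
    IsShortExact (ModuleCat.ofHom N.subtype) (ModuleCat.ofHom N.mkQ) :=
  IsShortExact.of_linearMap N.injective_subtype (LinearMap.exact_subtype_mkQ _) N.mkQ_surjective

/-- A homomorphism `P₀ → R` that vanishes on the image of `P₁` factors through `M`. -/
theorem exists_dual_factor {P₁ P₀ M : Type u} [AddCommGroup P₁] [Module R P₁] [AddCommGroup P₀]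
    [Module R P₀] [AddCommGroup M] [Module R M] {d : P₁ →ₗ[R] P₀} {p : P₀ →ₗ[R] M}
    (hdp : Function.Exact d p) (hp : Function.Surjective p) (φ : P₀ →ₗ[R] R)
    (hφ : dualMap d φ = 0) : ∃ φ' : M →ₗ[R] R, dualMap p φ' = φ := by
  have hk : LinearMap.ker p ≤ LinearMap.ker φ := fun x hx => by
    obtain ⟨y, rfl⟩ := (hdp x).1 hx
    exact LinearMap.congr_fun hφ y
  let e := p.quotKerEquivOfSurjective hp
  refine ⟨((LinearMap.ker p).liftQ φ hk).comp e.symm.toLinearMap, LinearMap.ext fun x => ?_⟩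
  have : e.symm (p x) = (LinearMap.ker p).mkQ x := by
    rw [LinearEquiv.symm_apply_eq]
    rfl
  change (LinearMap.ker p).liftQ φ hk (e.symm (p x)) = φ x
  rw [this]
  rfl

variable {P₁ P₀ : Type u} [AddCommGroup P₁] [Module R P₁] [AddCommGroup P₀] [Module R P₀]

variable [Module.Finite R P₁] [Module.Projective R P₁] [Module.Finite R P₀]
  [Module.Projective R P₀] {M : Type u} [AddCommGroup M] [Module R M]
  {d : P₁ →ₗ[R] P₀} {p : P₀ →ₗ[R] M}

theorem subsingleton_extDual_one_coker (hdp : Function.Exact d p)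
    (hM : IsTorsionless R M) :
    Subsingleton (extDual 1 (ModuleCat.of Rᵐᵒᵖ ((P₁ →ₗ[R] R) ⧸ LinearMap.range (dualMap d)))) := by
  have hs := isShortExact_subtype_mkQ (LinearMap.range (dualMap d))
  have := projective_dual R P₁
  refine subsingleton_of_forall_eq 0 fun e => ?_
  obtain ⟨e, rfl⟩ := surjective_connecting hs
    (subsingleton_extDual_of_projective (ModuleCat.of Rᵐᵒᵖ (P₁ →ₗ[R] R)) le_rfl) e
  rw [exact_extDualMap_connecting hs 0 e]
  obtain ⟨ψ, rfl⟩ := (dualEquiv _).surjective e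
  obtain ⟨x, hx⟩ := exists_eq_evalDual R (ψ.comp (dualMap d).rangeRestrict)
  have hx' (φ : P₀ →ₗ[R] R) : ψ ((dualMap d).rangeRestrict φ) = op (φ x) :=
    LinearMap.congr_fun hx φ
  have hpx : p x = 0 := hM _ fun φ => by
    have h0 : (dualMap d).rangeRestrict (dualMap p φ) = 0 := by
      ext y
      change φ (p (d y)) = 0
      rw [hdp.apply_apply_eq_zero, map_zero]
    have h1 := hx' (dualMap p φ)
    rw [h0, map_zero] at h1
    exact op_injective h1.symm
  obtain ⟨y, rfl⟩ := (hdp x).1 hpx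
  refine ⟨dualEquiv (ModuleCat.of Rᵐᵒᵖ (P₁ →ₗ[R] R)) (evalDual y), ?_⟩
  rw [extDualMap_dualEquiv]
  congr 1
  refine LinearMap.ext ?_
  rintro ⟨_, φ, rfl⟩
  exact (hx' φ).symm

theorem isTorsionless_of_subsingleton_extDual_one_coker (hdp : Function.Exact d p)
    (hp : Function.Surjective p)
    (hT : Subsingleton
      (extDual 1 (ModuleCat.of Rᵐᵒᵖ ((P₁ →ₗ[R] R) ⧸ LinearMap.range (dualMap d))))) :
    IsTorsionless R M := by
  have hs := isShortExact_subtype_mkQ (LinearMap.range (dualMap d))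
  intro x hx
  obtain ⟨x, rfl⟩ := hp x
  have hk : LinearMap.ker (dualMap d) ≤ LinearMap.ker (evalDual x) := fun φ hφ => by
    obtain ⟨φ, rfl⟩ := exists_dual_factor hdp hp φ hφ
    exact congrArg op (hx φ)
  let ψ : LinearMap.range (dualMap d) →ₗ[Rᵐᵒᵖ] Rᵐᵒᵖ :=
    ((LinearMap.ker (dualMap d)).liftQ _ hk).comp (dualMap d).quotKerEquivRange.symm.toLinearMap
  have hψ (φ : P₀ →ₗ[R] R) : ψ ((dualMap d).rangeRestrict φ) = op (φ x) := by
    have : (dualMap d).quotKerEquivRange.symm ((dualMap d).rangeRestrict φ) =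
        (LinearMap.ker (dualMap d)).mkQ φ := by
      rw [LinearEquiv.symm_apply_eq]
      rfl
    change (LinearMap.ker (dualMap d)).liftQ _ hk
      ((dualMap d).quotKerEquivRange.symm ((dualMap d).rangeRestrict φ)) = _
    rw [this]
    rfl
  obtain ⟨e, he⟩ := (exact_extDualMap_connecting hs 0
    (dualEquiv (ModuleCat.of Rᵐᵒᵖ (LinearMap.range (dualMap d))) ψ)).1 (Subsingleton.elim _ _)
  obtain ⟨Ψ, rfl⟩ := (dualEquiv (ModuleCat.of Rᵐᵒᵖ (P₁ →ₗ[R] R))).surjective e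
  rw [extDualMap_dualEquiv] at he
  have he := (dualEquiv _).injective he
  obtain ⟨y, rfl⟩ := exists_eq_evalDual R Ψ
  have hxy : x = d y := by
    rw [← sub_eq_zero]
    refine isTorsionless_of_projective R P₀ _ fun φ => ?_
    have h1 := LinearMap.congr_fun he ((dualMap d).rangeRestrict φ)
    rw [hψ] at h1
    rw [map_sub, sub_eq_zero]
    exact (op_injective h1).symm
  rw [hxy]
  exact hdp.apply_apply_eq_zero y

end Transpose

/-! ### The transpose along a short exact sequence -/

section TransposeSequence

variable {R : Type u} [Ring R]

/-- Given `A → B → C → D` with `B → C → D` left exact and `A → B → E → 0` exact, `E` is the kernel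
of the epimorphism from the cokernel of `A → C` onto the image of `C → D`. -/
theorem exists_coker_epi {A B C D E : Type u} [AddCommGroup A] [Module R A] [AddCommGroup B]
    [Module R B] [AddCommGroup C] [Module R C] [AddCommGroup D] [Module R D] [AddCommGroup E]
    [Module R E] {r : A →ₗ[R] B} {q : B →ₗ[R] C} {t : C →ₗ[R] D} {δ : B →ₗ[R] E}
    (hq : Function.Injective q) (hqt : Function.Exact q t) (hrδ : Function.Exact r δ)
    (hδ : Function.Surjective δ) {N : Submodule R C} (hN : ∀ c, c ∈ N ↔ ∃ a, q (r a) = c) :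
    ∃ β : (C ⧸ N) →ₗ[R] LinearMap.range t,
      Function.Surjective β ∧ Nonempty (E ≃ₗ[R] LinearMap.ker β) := by
  have hle : N ≤ LinearMap.ker t.rangeRestrict := fun c hc => by
    obtain ⟨a, rfl⟩ := (hN c).1 hc
    exact Subtype.ext (hqt.apply_apply_eq_zero _)
  have hker : LinearMap.ker δ = LinearMap.ker (N.mkQ.comp q) := by
    ext b
    rw [LinearMap.mem_ker, LinearMap.mem_ker, hrδ b, LinearMap.comp_apply, Submodule.mkQ_apply,
      Submodule.Quotient.mk_eq_zero, hN]
    exact exists_congr fun a => hq.eq_iff.symm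
  have hrange : LinearMap.range (N.mkQ.comp q) = LinearMap.ker (N.liftQ t.rangeRestrict hle) := by
    ext c
    obtain ⟨c, rfl⟩ := N.mkQ_surjective c
    rw [LinearMap.mem_ker, Submodule.mkQ_apply, Submodule.liftQ_apply]
    constructor
    · rintro ⟨b, hb⟩
      have hc : c - q b ∈ N := (Submodule.Quotient.eq N).1 hb.symm
      have h := hle hc
      rw [LinearMap.mem_ker, map_sub, sub_eq_zero] at h
      exact h.trans (Subtype.ext (hqt.apply_apply_eq_zero b))
    · intro hc
      obtain ⟨b, rfl⟩ := (hqt c).1 (congrArg Subtype.val hc)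
      exact ⟨b, rfl⟩
  refine ⟨N.liftQ t.rangeRestrict hle, fun x => ?_, ⟨(δ.quotKerEquivOfSurjective hδ).symm.trans
    ((Submodule.quotEquivOfEq _ _ hker).trans ((N.mkQ.comp q).quotKerEquivRange.trans
      (LinearEquiv.ofEq _ _ hrange)))⟩⟩
  obtain ⟨c, rfl⟩ := t.surjective_rangeRestrict x
  exact ⟨N.mkQ c, rfl⟩

theorem isShortExact_ker {A B : Type u} [AddCommGroup A] [Module R A] [AddCommGroup B]
    [Module R B] (f : A →ₗ[R] B) (hf : Function.Surjective f) :
    IsShortExact (ModuleCat.ofHom (LinearMap.ker f).subtype) (ModuleCat.ofHom f) :=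
  IsShortExact.of_linearMap (Submodule.injective_subtype _) (LinearMap.exact_subtype_ker_map f) hf

variable {M Q M' : ModuleCat.{u} R} {ι : M ⟶ Q} {ρ : Q ⟶ M'}
  {P₁ P₀ : ModuleCat.{u} R} {d : P₁ ⟶ P₀} {p : P₀ ⟶ M}

/-- If `0 → M → Q → M' → 0` is exact with `Q` projective and `P₁ → P₀ → M → 0` is a projective
presentation, then `Ext¹(M', R)` is the kernel of the canonical epimorphism from
`Coker(Q* → P₀*)`, a transpose of `M'`, onto the image of `P₀* → P₁*`. -/
theorem exists_transpose_epi [Module.Projective R Q] (hs : IsShortExact ι ρ)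
    (hdp : Function.Exact d.hom p.hom) (hp : Function.Surjective p.hom) :
    ∃ β : ((P₀ →ₗ[R] R) ⧸ LinearMap.range (dualMap (p ≫ ι).hom)) →ₗ[Rᵐᵒᵖ]
        LinearMap.range (dualMap d.hom),
      Function.Surjective β ∧ Nonempty (extDual 1 M' ≃ₗ[Rᵐᵒᵖ] LinearMap.ker β) := by
  refine exists_coker_epi (R := Rᵐᵒᵖ) (r := dualMap ι.hom) (q := dualMap p.hom)
    (t := dualMap d.hom) (δ := (connecting hs 0).hom.comp (dualEquiv M).toLinearMap)
    (fun φ ψ h => ?_) (fun φ => ⟨exists_dual_factor hdp hp φ, ?_⟩)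
    (fun φ => (exact_extDualMap_connecting hs 0 (dualEquiv M φ)).trans ⟨?_, ?_⟩)
    ((surjective_connecting hs (subsingleton_extDual_of_projective Q le_rfl)).comp
      (dualEquiv M).surjective) fun φ => Iff.rfl
  · ext x
    obtain ⟨x, rfl⟩ := hp x
    exact LinearMap.congr_fun h x
  · rintro ⟨φ, rfl⟩
    ext x
    change φ (p.hom (d.hom x)) = 0
    rw [hdp.apply_apply_eq_zero, map_zero]
  · rintro ⟨e, he⟩
    obtain ⟨χ, rfl⟩ := (dualEquiv Q).surjective e
    refine ⟨χ, (dualEquiv M).injective ?_⟩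
    rw [← he]
    exact (extDualMap_dualEquiv ι χ).symm
  · rintro ⟨χ, rfl⟩
    exact ⟨dualEquiv Q χ, extDualMap_dualEquiv ι χ⟩

/-- A transpose `T` of `M` determines a transpose `T'` of `M'` whenever `0 → M → Q → M' → 0` is
exact with `Q` finitely generated projective. They are linked by an exact sequence
`0 → Ext¹(M', R) → T' → P₁* → T → 0` with `P₁*` projective, which relates the vanishing of
`Ext(T, R)` to that of `Ext(T', R)`. -/
theorem IsTranspose.exists_of_isShortExact [Module.Finite R Q] [Module.Projective R Q]
    (hs : IsShortExact ι ρ) {T : ModuleCat.{u} Rᵐᵒᵖ} (hT : IsTranspose M T) :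
    ∃ T', IsTranspose M' T' ∧
      (∀ q, Subsingleton (extDual (q + 1) T') → Subsingleton (extDual q (extDual 1 M')) →
        Subsingleton (extDual (q + 2) T)) ∧
      (Subsingleton (extDual 1 M') → ∀ q, Subsingleton (extDual (q + 2) T) →
        Subsingleton (extDual (q + 1) T')) := by
  obtain ⟨P₁, P₀, d, p, _, _, _, _, hdp, hp, ⟨eT⟩⟩ := hT
  obtain ⟨β, hβ, ⟨e⟩⟩ := exists_transpose_epi hs hdp hp
  have hJ := isShortExact_subtype_mkQ (LinearMap.range (dualMap d.hom))
  have hK := isShortExact_ker (R := Rᵐᵒᵖ)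
    (A := (P₀ →ₗ[R] R) ⧸ LinearMap.range (dualMap (p ≫ ι).hom))
    (B := LinearMap.range (dualMap d.hom)) β hβ
  have := projective_dual R P₁
  have hP (q : ℕ) : Subsingleton (extDual (q + 1) (ModuleCat.of Rᵐᵒᵖ (P₁ →ₗ[R] R))) :=
    subsingleton_extDual_of_projective _ (Nat.succ_pos q)
  refine ⟨ModuleCat.of Rᵐᵒᵖ ((P₀ →ₗ[R] R) ⧸ LinearMap.range (dualMap (p ≫ ι).hom)),
    ⟨P₀, Q, p ≫ ι, ρ, ‹_›, ‹_›, ‹_›, ‹_›, ?_, hs.surjective, ⟨LinearEquiv.refl _ _⟩⟩,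
    fun q h₁ h₂ => ?_, fun h₁ q h₂ => ?_⟩
  · intro x
    rw [hs.exact x]
    constructor
    · rintro ⟨y, rfl⟩
      obtain ⟨z, rfl⟩ := hp y
      exact ⟨z, rfl⟩
    · rintro ⟨z, rfl⟩
      exact ⟨p.hom z, rfl⟩
  · have h₃ := subsingleton_extDual_right hK (subsingleton_extDual_of_iso e.toModuleIso h₂) h₁
    exact subsingleton_extDual_of_iso eT.symm.toModuleIso
      (subsingleton_extDual_right hJ h₃ (hP (q + 1)))
  · have h₃ := subsingleton_extDual_left hJ (hP q)
      (subsingleton_extDual_of_iso eT.toModuleIso h₂)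
    have : Subsingleton (LinearMap.ker β) := e.symm.injective.subsingleton
    exact subsingleton_extDual_middle hK
      (subsingleton_extDual_of_subsingleton (ModuleCat.of Rᵐᵒᵖ (LinearMap.ker β)) _) h₃

/-- `M` is torsionless if and only if `Ext¹(Tr M, R) = 0`. -/
theorem IsTranspose.subsingleton_extDual_one_iff {T : ModuleCat.{u} Rᵐᵒᵖ} (hT : IsTranspose M T) :
    Subsingleton (extDual 1 T) ↔ IsTorsionless R M := by
  obtain ⟨P₁, P₀, d, p, _, _, _, _, hdp, hp, ⟨eT⟩⟩ := hT
  exact ⟨fun h => isTorsionless_of_subsingleton_extDual_one_coker hdp hp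
      (subsingleton_extDual_of_iso eT.toModuleIso h),
    fun h => subsingleton_extDual_of_iso eT.symm.toModuleIso
      (subsingleton_extDual_one_coker hdp h)⟩

end TransposeSequence

/-! ### Syzygies -/

section Syzygies

variable {R : Type u} [Ring R]

theorem isSyzygy_add {a b : ℕ} {C S : ModuleCat.{u} R} :
    IsSyzygy (a + b) C S ↔ ∃ D, IsSyzygy a C D ∧ IsSyzygy b D S := by
  induction a generalizing C with
  | zero =>
    rw [Nat.zero_add]
    refine ⟨fun h => ⟨C, ⟨Iso.refl _⟩, h⟩, ?_⟩
    rintro ⟨D, ⟨e⟩, h⟩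
    cases b with
    | zero => exact ⟨h.some ≪≫ e⟩
    | succ b =>
      obtain ⟨K, P, f, g, hP, hP', hs, h⟩ := h
      refine ⟨K, P, f, g ≫ e.hom, hP, hP', ?_, h⟩
      refine isShortExact_iff.2 ⟨hs.injective, fun x => ?_, ?_⟩
      · rw [← hs.exact x]
        exact e.toLinearEquiv.map_eq_zero_iff
      · exact e.toLinearEquiv.surjective.comp hs.surjective
  | succ a ih =>
    rw [Nat.succ_add]
    constructor
    · rintro ⟨K, P, f, g, hP, hP', hs, h⟩
      obtain ⟨D, h₁, h₂⟩ := ih.1 h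
      exact ⟨D, ⟨K, P, f, g, hP, hP', hs, h₁⟩, h₂⟩
    · rintro ⟨D, ⟨K, P, f, g, hP, hP', hs, h₁⟩, h₂⟩
      exact ⟨K, P, f, g, hP, hP', hs, ih.2 ⟨D, h₁, h₂⟩⟩

theorem isSyzygy_one {C S : ModuleCat.{u} R} :
    IsSyzygy 1 C S ↔ ∃ (P : ModuleCat.{u} R) (f : S ⟶ P) (g : P ⟶ C),
      Module.Finite R P ∧ Module.Projective R P ∧ IsShortExact f g := by
  constructor
  · rintro ⟨K, P, f, g, hP, hP', hs, ⟨e⟩⟩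
    refine ⟨P, e.hom ≫ f, g, hP, hP', isShortExact_iff.2 ⟨?_, fun x => ?_, hs.surjective⟩⟩
    · exact hs.injective.comp e.toLinearEquiv.injective
    · rw [hs.exact x]
      exact (e.toLinearEquiv.surjective.range_comp f.hom ▸ Iff.rfl)
  · rintro ⟨P, f, g, hP, hP', hs⟩
    exact ⟨S, P, f, g, hP, hP', hs, ⟨Iso.refl _⟩⟩

theorem finite_of_isShortExact [IsNoetherianRing R] {X Y Z : ModuleCat.{u} R} {f : X ⟶ Y}
    {g : Y ⟶ Z} (hs : IsShortExact f g) [Module.Finite R Y] : Module.Finite R X :=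
  Module.Finite.of_injective f.hom hs.injective

theorem IsSyzygy.finite [IsNoetherianRing R] {n : ℕ} {C S : ModuleCat.{u} R}
    (h : IsSyzygy n C S) [Module.Finite R C] : Module.Finite R S := by
  induction n generalizing C with
  | zero => exact Module.Finite.equiv h.some.toLinearEquiv.symm
  | succ n ih =>
    obtain ⟨K, P, f, g, hP, hP', hs, h⟩ := h
    have := finite_of_isShortExact hs
    exact ih h

theorem exists_isSyzygy [IsNoetherianRing R] (n : ℕ) (C : ModuleCat.{u} R) [Module.Finite R C] :
    ∃ S, IsSyzygy n C S := by
  induction n generalizing C with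
  | zero => exact ⟨C, ⟨Iso.refl _⟩⟩
  | succ n ih =>
    obtain ⟨m, p, hp⟩ := Module.Finite.exists_fin' R C
    have hs := isShortExact_ker p hp
    obtain ⟨S, hS⟩ := ih (ModuleCat.of R (LinearMap.ker p))
    exact ⟨S, ModuleCat.of R (LinearMap.ker p), ModuleCat.of R (Fin m → R), _, _,
      inferInstanceAs (Module.Finite R (Fin m → R)),
      inferInstanceAs (Module.Projective R (Fin m → R)), hs, hS⟩

theorem IsSyzygy.isTorsionless {n : ℕ} {C S : ModuleCat.{u} R} (h : IsSyzygy (n + 1) C S) :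
    IsTorsionless R S := by
  obtain ⟨D, -, h⟩ := isSyzygy_add.1 h
  obtain ⟨P, f, g, _, _, hs⟩ := isSyzygy_one.1 h
  exact (isTorsionless_of_projective R P).of_injective f.hom hs.injective

/-- Dimension shift along a syzygy. -/
theorem IsSyzygy.nonempty_iso {n : ℕ} {C S : ModuleCat.{u} R} (h : IsSyzygy n C S) {m : ℕ}
    (hm : 1 ≤ m) : Nonempty (extDual m S ≅ extDual (m + n) C) := by
  induction n generalizing C with
  | zero => exact ⟨extDualIso m h.some⟩
  | succ n ih =>
    obtain ⟨K, P, f, g, hP, hP', hs, h⟩ := h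
    obtain ⟨e⟩ := ih h
    obtain ⟨e'⟩ := nonempty_iso_of_vanishing hs (n := m + n)
      (subsingleton_extDual_of_projective P (by lia))
      (subsingleton_extDual_of_projective P (by lia))
    exact ⟨e ≪≫ e'⟩

end Syzygies

/-! ### Grade and reduced grade -/

section Grade

variable {R : Type u} [Ring R]

theorem le_grade_iff {X : ModuleCat.{u} R} {i : ℕ} :
    (i : ℕ∞) ≤ grade X ↔ ∀ j < i, Subsingleton (extDual j X) := by
  constructor
  · intro h j hj
    by_contra hX
    rw [not_subsingleton_iff_nontrivial] at hX
    have hle : grade X ≤ j := sInf_le ⟨j, rfl, hX⟩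
    exact absurd (Nat.cast_le.1 (h.trans hle)) (by lia)
  · intro h
    refine le_sInf ?_
    rintro _ ⟨j, rfl, hX⟩
    by_contra hj
    exact not_subsingleton_iff_nontrivial.2 hX (h j (by exact_mod_cast not_le.1 hj))

theorem lt_rgrade_iff {X : ModuleCat.{u} R} {m : ℕ} :
    (m : ℕ∞) < rgrade X ↔ ∀ j, 1 ≤ j → j ≤ m → Subsingleton (extDual j X) := by
  constructor
  · intro h j hj hjm
    by_contra hX
    rw [not_subsingleton_iff_nontrivial] at hX
    have hle : rgrade X ≤ j := sInf_le ⟨j, hj, rfl, hX⟩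
    exact absurd (Nat.cast_lt.1 (h.trans_le hle)) (by lia)
  · intro h
    have : ((m + 1 : ℕ) : ℕ∞) ≤ rgrade X := by
      refine le_sInf ?_
      rintro _ ⟨j, hj, rfl, hX⟩
      by_contra hjm
      have hjm : j < m + 1 := by exact_mod_cast not_le.1 hjm
      exact not_subsingleton_iff_nontrivial.2 hX (h j hj (by lia))
    exact lt_of_lt_of_le (by exact_mod_cast Nat.lt_succ_self m) this

theorem le_grade_of_iso {X Y : ModuleCat.{u} R} (e : X ≅ Y) {i : ℕ} (h : (i : ℕ∞) ≤ grade X) :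
    (i : ℕ∞) ≤ grade Y :=
  le_grade_iff.2 fun j hj => subsingleton_extDual_of_iso e (le_grade_iff.1 h j hj)

end Grade

/-! ### Torsionfreeness of syzygies -/

section TorsionfreeSyzygies

variable {R : Type u} [Ring R]

/-- If `grade Extʲ⁺¹(C, R) ≥ j` for all `j < m`, then `Ωᵐ C` is `m`-torsionfree. The vanishing is
carried from a transpose of `Ωʲ C` to one of `Ωʲ⁺¹ C`, the error term being
`Ext¹(Ωʲ C, R) ≅ Extʲ⁺¹(C, R)`. -/
theorem IsSyzygy.subsingleton_extDual_transpose {m : ℕ} {C X : ModuleCat.{u} R}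
    (hX : IsSyzygy m C X) (hC : ∀ j < m, (j : ℕ∞) ≤ grade (extDual (j + 1) C))
    {T : ModuleCat.{u} Rᵐᵒᵖ} (hT : IsTranspose X T) :
    ∀ q, 1 ≤ q → q ≤ m → Subsingleton (extDual q T) := by
  induction m generalizing X T with
  | zero => exact fun q h₁ h₂ => absurd h₁ (by lia)
  | succ m ih =>
    intro q h₁ h₂
    obtain rfl | ⟨q, rfl⟩ : q = 1 ∨ ∃ q', q = q' + 2 := by
      obtain h | h := h₁.eq_or_lt
      · exact Or.inl h.symm
      · exact Or.inr ⟨q - 2, by lia⟩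
    · exact hT.subsingleton_extDual_one_iff.2 hX.isTorsionless
    · obtain ⟨D, hD, hX⟩ := isSyzygy_add.1 hX
      obtain ⟨P, f, g, _, _, hs⟩ := isSyzygy_one.1 hX
      obtain ⟨T', hT', hTT', -⟩ := hT.exists_of_isShortExact hs
      obtain ⟨e⟩ := hD.nonempty_iso le_rfl
      refine hTT' q (ih hD (fun j hj => hC j (by lia)) hT' _ (by lia) (by lia)) ?_
      refine subsingleton_extDual_of_iso e.symm (le_grade_iff.1 ?_ q (by lia : q < m))
      rw [add_comm 1 m]
      exact hC m (by lia)

end TorsionfreeSyzygies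

/-! ### Approximations by modules of large reduced grade -/

section Approximation

variable {R : Type u} [Ring R]

theorem IsShortExact.hasProjectiveDimensionLT_left {X Y Z : ModuleCat.{u} R} {f : X ⟶ Y}
    {g : Y ⟶ Z} (hs : IsShortExact f g) {n : ℕ} (hY : HasProjectiveDimensionLT Y n)
    (hZ : HasProjectiveDimensionLT Z (n + 1)) : HasProjectiveDimensionLT X n :=
  hs.choose_spec.hasProjectiveDimensionLT_X₁ n hY hZ

theorem IsShortExact.hasProjectiveDimensionLT_middle {X Y Z : ModuleCat.{u} R} {f : X ⟶ Y}
    {g : Y ⟶ Z} (hs : IsShortExact f g) {n : ℕ} (hX : HasProjectiveDimensionLT X n)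
    (hZ : HasProjectiveDimensionLT Z n) : HasProjectiveDimensionLT Y n :=
  hs.choose_spec.hasProjectiveDimensionLT_X₂ n hX hZ

theorem IsShortExact.hasProjectiveDimensionLT_right {X Y Z : ModuleCat.{u} R} {f : X ⟶ Y}
    {g : Y ⟶ Z} (hs : IsShortExact f g) {n : ℕ} (hX : HasProjectiveDimensionLT X n)
    (hY : HasProjectiveDimensionLT Y (n + 1)) : HasProjectiveDimensionLT Z (n + 1) :=
  hs.choose_spec.hasProjectiveDimensionLT_X₃ n hX hY

theorem hasProjectiveDimensionLT_of_projective (P : ModuleCat.{u} R) [Module.Projective R P]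
    {n : ℕ} (hn : 1 ≤ n) : HasProjectiveDimensionLT P n := by
  have : Projective P := (IsProjective.iff_projective P).1 inferInstance
  exact hasProjectiveDimensionLT_of_ge P 1 n hn

theorem projective_of_hasProjectiveDimensionLT (P : ModuleCat.{u} R)
    [HasProjectiveDimensionLT P 1] : Module.Projective R P :=
  (IsProjective.iff_projective P).2 inferInstance

/-- A syzygy lowers the projective dimension until it reaches `0`. -/
theorem IsSyzygy.hasProjectiveDimensionLT {n m : ℕ} {C S : ModuleCat.{u} R} (h : IsSyzygy n C S)
    (hm : 1 ≤ m) (hC : HasProjectiveDimensionLT C (m + n)) : HasProjectiveDimensionLT S m := by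
  induction n generalizing C with
  | zero => exact hasProjectiveDimensionLT_of_iso h.some.symm m
  | succ n ih =>
    obtain ⟨K, P, f, g, hP, hP', hs, h⟩ := h
    exact ih h (hs.hasProjectiveDimensionLT_left
      (hasProjectiveDimensionLT_of_projective P (by lia)) hC)

theorem finite_dual_of_finite [IsNoetherianRing Rᵐᵒᵖ] (M : Type u) [AddCommGroup M] [Module R M]
    [Module.Finite R M] : Module.Finite Rᵐᵒᵖ (M →ₗ[R] R) := by
  obtain ⟨n, p, hp⟩ := Module.Finite.exists_fin' R M
  have := finite_dual R (Fin n → R)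
  refine Module.Finite.of_injective (dualMap p) fun φ ψ h => LinearMap.ext fun x => ?_
  obtain ⟨x, rfl⟩ := hp x
  exact LinearMap.congr_fun h x

/-- Finitely many generators of `Hom(M, R)` embed a torsionless module `M` into a free module `Q`
such that every homomorphism `M → R` extends to `Q`. -/
theorem IsTorsionless.exists_embedding [IsNoetherianRing Rᵐᵒᵖ] {M : Type u} [AddCommGroup M]
    [Module R M] [Module.Finite R M] (hM : IsTorsionless R M) :
    ∃ (n : ℕ) (j : M →ₗ[R] (Fin n → R)), Function.Injective j ∧
      Function.Surjective (dualMap j) := by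
  have := finite_dual_of_finite (R := R) M
  obtain ⟨n, s, hs⟩ := Module.Finite.exists_fin (R := Rᵐᵒᵖ) (M := M →ₗ[R] R)
  have hr : LinearMap.range (dualMap (LinearMap.pi s)) = ⊤ := by
    rw [eq_top_iff, ← hs, Submodule.span_le]
    rintro _ ⟨i, rfl⟩
    exact ⟨LinearMap.proj i, rfl⟩
  have hsurj : Function.Surjective (dualMap (LinearMap.pi s)) := LinearMap.range_eq_top.1 hr
  refine ⟨n, LinearMap.pi s, ?_, hsurj⟩
  rw [injective_iff_map_eq_zero]
  refine fun x hx => hM x fun φ => ?_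
  obtain ⟨χ, rfl⟩ := hsurj φ
  change χ (LinearMap.pi s x) = 0
  rw [hx, map_zero]

/-- If every homomorphism `X → R` extends along `f : X → Y`, with `Y` projective, then
`Ext¹(Coker f, R) = 0`. -/
theorem subsingleton_extDual_one_of_surjective {X Y Z : ModuleCat.{u} R} {f : X ⟶ Y}
    {g : Y ⟶ Z} (hs : IsShortExact f g) [Module.Projective R Y]
    (hf : Function.Surjective (dualMap f.hom)) : Subsingleton (extDual 1 Z) := by
  refine subsingleton_of_forall_eq 0 fun e => ?_
  obtain ⟨e, rfl⟩ := surjective_connecting hs (subsingleton_extDual_of_projective Y le_rfl) e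
  obtain ⟨φ, rfl⟩ := (dualEquiv X).surjective e
  obtain ⟨χ, rfl⟩ := hf φ
  rw [exact_extDualMap_connecting hs 0]
  exact ⟨dualEquiv Y χ, extDualMap_dualEquiv f χ⟩

/-- One step of the construction of approximations: from `0 → Y → X → L → 0` and a syzygy
sequence `0 → L → P → D → 0`, embed `X` into `Rⁿ × P` compatibly with `X → L → P`. The cokernel
`X'` maps onto `D`, and the kernel `Y'` of `X' → D` is `Rⁿ / Y`. -/
theorem exists_approximation_step {Y X L P D : ModuleCat.{u} R} {y : Y ⟶ X} {x : X ⟶ L}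
    {f : L ⟶ P} {g : P ⟶ D} (hs : IsShortExact y x) (hL : IsShortExact f g) {n : ℕ}
    (j : X →ₗ[R] (Fin n → R)) (hj : Function.Injective j) :
    ∃ (Y' X' : ModuleCat.{u} R) (y' : Y' ⟶ X') (x' : X' ⟶ D)
      (c : ModuleCat.of R ((Fin n → R) × P) ⟶ X')
      (a : Y ⟶ ModuleCat.of R (Fin n → R)) (b : ModuleCat.of R (Fin n → R) ⟶ Y'),
      IsShortExact y' x' ∧
        IsShortExact (ModuleCat.ofHom (j.prod (f.hom.comp x.hom)) :
          X ⟶ ModuleCat.of R ((Fin n → R) × P)) c ∧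
        IsShortExact a b := by
  let J : X →ₗ[R] (Fin n → R) × P := j.prod (f.hom.comp x.hom)
  have hJ : Function.Injective J := fun u v h => hj (congrArg Prod.fst h)
  have hfg (l : L) : g.hom (f.hom l) = 0 := hL.exact.apply_apply_eq_zero l
  have hle : LinearMap.range J ≤ LinearMap.ker (g.hom.comp (LinearMap.snd R (Fin n → R) P)) := by
    rintro _ ⟨u, rfl⟩
    exact hfg _
  let x' := (LinearMap.range J).liftQ _ hle
  have hx' : Function.Surjective x' := fun z => by
    obtain ⟨p, rfl⟩ := hL.surjective z
    exact ⟨(LinearMap.range J).mkQ (0, p), rfl⟩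
  let b : (Fin n → R) →ₗ[R] LinearMap.ker x' :=
    ((LinearMap.range J).mkQ.comp (LinearMap.inl R (Fin n → R) P)).codRestrict _ fun v => by
      change g.hom 0 = 0
      rw [map_zero]
  refine ⟨_, _, _, _, ModuleCat.ofHom (LinearMap.range J).mkQ,
    ModuleCat.ofHom (j.comp y.hom), ModuleCat.ofHom b, isShortExact_ker x' hx', ?_, ?_⟩
  · exact IsShortExact.of_linearMap hJ (LinearMap.exact_map_mkQ_range J)
      (LinearMap.range J).mkQ_surjective
  · refine IsShortExact.of_linearMap (hj.comp hs.injective) (fun v => ?_) ?_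
    · have hb : b v = 0 ↔ (v, (0 : P)) ∈ LinearMap.range J :=
        Subtype.ext_iff.trans (Submodule.Quotient.mk_eq_zero _)
      rw [hb]
      constructor
      · rintro ⟨u, hu⟩
        have h₁ : j u = v := congrArg Prod.fst hu
        have h₂ : f.hom (x.hom u) = 0 := congrArg Prod.snd hu
        obtain ⟨w, rfl⟩ := (hs.exact u).1 (hL.injective (h₂.trans (map_zero _).symm))
        exact ⟨w, h₁⟩
      · rintro ⟨w, rfl⟩
        refine ⟨y.hom w, Prod.ext rfl ?_⟩
        change f.hom (x.hom (y.hom w)) = 0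
        rw [hs.exact.apply_apply_eq_zero, map_zero]
    · rintro ⟨z, hz⟩
      obtain ⟨⟨v, p⟩, rfl⟩ := (LinearMap.range J).mkQ_surjective z
      obtain ⟨l, rfl⟩ := (hL.exact p).1 hz
      obtain ⟨u, rfl⟩ := hs.surjective l
      refine ⟨v - j u, Subtype.ext ((Submodule.Quotient.eq _).2 ⟨-u, ?_⟩)⟩
      refine Prod.ext ?_ ?_
      · change j (-u) = v - j u - v
        rw [map_neg]
        abel
      · change f.hom (x.hom (-u)) = 0 - f.hom (x.hom u)
        rw [map_neg, map_neg, zero_sub]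

/-- An approximation `0 → Y → X → Ωʲ C → 0`, with `X` sufficiently torsionfree, yields an
approximation of `C`. -/
theorem exists_approximation [IsNoetherianRing Rᵐᵒᵖ] {j a : ℕ} {C L Y X : ModuleCat.{u} R}
    (hL : IsSyzygy j C L) {y : Y ⟶ X} {x : X ⟶ L} (hs : IsShortExact y x) [Module.Finite R X]
    {T : ModuleCat.{u} Rᵐᵒᵖ} (hT : IsTranspose X T)
    (hTj : ∀ q, 1 ≤ q → q ≤ j → Subsingleton (extDual q T))
    (hX : ∀ q, 1 ≤ q → q ≤ a → Subsingleton (extDual q X))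
    (hY : HasProjectiveDimensionLT Y a) :
    ∃ (Y' X' : ModuleCat.{u} R) (y' : Y' ⟶ X') (x' : X' ⟶ C), IsShortExact y' x' ∧
      Module.Finite R X' ∧ (∀ q, 1 ≤ q → q ≤ a + j → Subsingleton (extDual q X')) ∧
      HasProjectiveDimensionLT Y' (a + j) := by
  induction j generalizing a L Y X T with
  | zero =>
    obtain ⟨e⟩ := hL
    refine ⟨Y, X, y, x ≫ e.hom, isShortExact_iff.2 ⟨hs.injective, fun u => ?_,
      e.toLinearEquiv.surjective.comp hs.surjective⟩, ‹_›, hX, hY⟩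
    rw [← hs.exact u]
    exact e.toLinearEquiv.map_eq_zero_iff
  | succ j ih =>
    obtain ⟨D, hD, hL⟩ := isSyzygy_add.1 hL
    obtain ⟨P, f, g, _, _, hfg⟩ := isSyzygy_one.1 hL
    obtain ⟨n, i, hi, hi'⟩ := (hT.subsingleton_extDual_one_iff.1
      (hTj 1 le_rfl (by lia))).exists_embedding
    obtain ⟨Y', X', y', x', c, r, b, h₁, h₂, h₃⟩ := exists_approximation_step hs hfg i hi
    have : Module.Projective R (ModuleCat.of R ((Fin n → R) × P)) :=
      inferInstanceAs (Module.Projective R ((Fin n → R) × P))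
    have : Module.Finite R (ModuleCat.of R ((Fin n → R) × P)) :=
      inferInstanceAs (Module.Finite R ((Fin n → R) × P))
    have : Module.Projective R (ModuleCat.of R (Fin n → R)) :=
      inferInstanceAs (Module.Projective R (Fin n → R))
    have hX'₁ : Subsingleton (extDual 1 X') := by
      refine subsingleton_extDual_one_of_surjective h₂ fun φ => ?_
      obtain ⟨χ, rfl⟩ := hi' φ
      exact ⟨χ.comp (LinearMap.fst R _ _), rfl⟩
    obtain ⟨T', hT', -, hTT'⟩ := hT.exists_of_isShortExact h₂
    have : Module.Finite R X' := Module.Finite.of_surjective c.hom h₂.surjective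
    have hX' (q : ℕ) (hq : 1 ≤ q) (hqa : q ≤ a + 1) : Subsingleton (extDual q X') := by
      obtain rfl | hq := hq.eq_or_lt
      · exact hX'₁
      · obtain ⟨q, rfl⟩ := Nat.exists_eq_add_of_le' hq.le
        exact subsingleton_extDual_right h₂ (hX q (by lia) (by lia))
          (subsingleton_extDual_of_projective _ (by lia))
    have hT'j (q : ℕ) (hq : 1 ≤ q) (hqj : q ≤ j) : Subsingleton (extDual q T') := by
      obtain ⟨q, rfl⟩ := Nat.exists_eq_add_of_le' hq
      exact hTT' hX'₁ q (hTj _ (by lia) (by lia))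
    have hY' := h₃.hasProjectiveDimensionLT_right hY
      (hasProjectiveDimensionLT_of_projective _ (by lia))
    rw [← add_assoc, add_right_comm]
    exact ih hD h₁ hT' hT'j hX' hY'

end Approximation

/-! ### The grade condition and double duals of monomorphisms -/

section GradeCondition

variable {Λ : Type u} [Ring Λ]

theorem omega_of_projective (n : ℕ) (P : ModuleCat.{u} Λ) [Module.Finite Λ P]
    [Module.Projective Λ P] : Omega Λ n P := by
  have h0 (m : ℕ) :
      IsSyzygy m (ModuleCat.of Λ PUnit.{u + 1}) (ModuleCat.of Λ PUnit.{u + 1}) := by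
    induction m with
    | zero => exact ⟨Iso.refl _⟩
    | succ m ih =>
      exact ⟨_, _, 𝟙 _, 𝟙 _, inferInstanceAs (Module.Finite Λ PUnit.{u + 1}),
        inferInstanceAs (Module.Projective Λ PUnit.{u + 1}),
        isShortExact_iff.2 ⟨Function.injective_id, fun x => ⟨fun _ => ⟨x, rfl⟩, fun _ => rfl⟩,
          Function.surjective_id⟩, ih⟩
  cases n with
  | zero => exact ⟨P, ‹_›, ⟨Iso.refl _⟩⟩
  | succ m =>
    refine ⟨ModuleCat.of Λ PUnit.{u + 1}, inferInstanceAs (Module.Finite Λ PUnit.{u + 1}),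
      isSyzygy_add.2 ⟨_, h0 m, isSyzygy_one.2 ⟨P, 𝟙 _, 0, ‹_›, ‹_›, isShortExact_iff.2
        ⟨Function.injective_id, fun x => ⟨fun _ => ⟨x, rfl⟩, fun _ => rfl⟩, fun x => ⟨0, rfl⟩⟩⟩⟩⟩

/-- If `0 → A → P → D → 0` is exact with `P` projective and `Ext¹(D, Λ)* = 0`, then `A** → P**` is
a monomorphism. -/
theorem eq_zero_of_dualMap_extDualMap_zero_eq_zero {A P D : ModuleCat.{u} Λ} {f : A ⟶ P} {g : P ⟶ D}
    (hs : IsShortExact f g) [Module.Projective Λ P]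
    (hD : Subsingleton (extDual 0 (extDual 1 D))) (ψ : extDual 0 A →ₗ[Λᵐᵒᵖ] Λᵐᵒᵖ)
    (hψ : dualMap (extDualMap 0 f).hom ψ = 0) : ψ = 0 := by
  obtain ⟨φ, rfl⟩ := exists_dual_factor (exact_extDualMap_connecting hs 0)
    (surjective_connecting hs (subsingleton_extDual_of_projective P le_rfl)) ψ hψ
  rw [subsingleton_extDual_zero_iff.1 hD φ, map_zero]

theorem mono_extDualMap_zero {X Y : ModuleCat.{u} Λ} {f : X ⟶ Y}
    (h : ∀ ψ : Y →ₗ[Λ] Λ, dualMap f.hom ψ = 0 → ψ = 0) : Mono (extDualMap 0 f) := by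
  rw [ModuleCat.mono_iff_injective]
  refine (injective_iff_map_eq_zero (extDualMap 0 f).hom).2 fun e he => ?_
  obtain ⟨ψ, rfl⟩ := (dualEquiv Y).surjective e
  rw [h ψ ((dualEquiv X).injective ?_), map_zero]
  rw [map_zero, ← he]
  exact (extDualMap_dualEquiv f ψ).symm

/-- Under `gₙ(k)` with `n ≥ 1`, a monomorphism `f : A → B` in `Ωᵏ⁺¹(mod Λ)` induces a
monomorphism `A** → B**`. For `k > 0` this holds because `A` is reflexive; for `k = 0` because `B`
embeds into a projective module `Q` and `Ext¹(Q / A, Λ)* = 0`. -/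
theorem IsSmallG.mono_extDualMap_zero_extDualMap_zero {n k : ℕ} [IsNoetherianRing Λ]
    (h : IsSmallG Λ n k) (hn : 0 < n)
    {A B : ModuleCat.{u} Λ} (f : A ⟶ B) (hA : Omega Λ (k + 1) A) (hB : Omega Λ (k + 1) B)
    (hf : Mono f) : Mono (extDualMap 0 (extDualMap 0 f)) := by
  have hf' : Function.Injective f.hom := (ModuleCat.mono_iff_injective f).1 hf
  obtain ⟨A', hA', hA⟩ := hA
  obtain ⟨B', hB', hB⟩ := hB
  refine mono_extDualMap_zero fun ψ hψ => ?_
  have h1 (C : ModuleCat.{u} Λ) [Module.Finite Λ C] :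
      Subsingleton (extDual 0 (extDual (1 + k) C)) :=
    le_grade_iff.1 (h C ‹_› 1 le_rfl hn) 0 Nat.zero_lt_one
  cases k with
  | zero =>
    obtain ⟨Q, j, r, _, _, hs⟩ := isSyzygy_one.1 hB
    have hs' : IsShortExact (f ≫ j) (ModuleCat.ofHom (LinearMap.range (f ≫ j).hom).mkQ) :=
      isShortExact_iff.2 ⟨hs.injective.comp hf', LinearMap.exact_map_mkQ_range _,
        Submodule.mkQ_surjective _⟩
    refine eq_zero_of_dualMap_extDualMap_zero_eq_zero hs' (h1 _) ψ ?_
    rw [extDualMap_comp]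
    exact LinearMap.ext fun e => LinearMap.congr_fun hψ (extDualMap 0 j e)
  | succ k =>
    obtain ⟨D, hD, hA⟩ := isSyzygy_add.1 hA
    obtain ⟨P, ι, ρ, _, _, hs⟩ := isSyzygy_one.1 hA
    obtain ⟨e⟩ := hD.nonempty_iso (m := 1) le_rfl
    have hD1 := subsingleton_extDual_of_iso e.symm (h1 A')
    -- `ψ`, restricted to `P*`, is evaluation at some `x ∈ P`; as `D` is torsionless, `x ∈ A`.
    obtain ⟨x, hx⟩ := exists_eq_evalDual Λ
      ((ψ.comp (dualEquiv A).toLinearMap).comp (dualMap ι.hom))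
    have hx' (φ : P →ₗ[Λ] Λ) : ψ (dualEquiv A (dualMap ι.hom φ)) = op (φ x) :=
      LinearMap.congr_fun hx φ
    have hρx : ρ.hom x = 0 := hD.isTorsionless _ fun φ => by
      have h0 : dualMap ι.hom (dualMap ρ.hom φ) = 0 := by
        ext a
        change φ (ρ.hom (ι.hom a)) = 0
        rw [hs.exact.apply_apply_eq_zero, map_zero]
      have h2 := hx' (dualMap ρ.hom φ)
      rw [h0, map_zero, map_zero] at h2
      exact op_injective h2.symm
    obtain ⟨a, rfl⟩ := (hs.exact x).1 hρx
    have hψa : ψ - (evalDual a).comp (dualEquiv A).symm.toLinearMap = 0 := by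
      refine eq_zero_of_dualMap_extDualMap_zero_eq_zero hs hD1 _ ?_
      refine LinearMap.ext fun e => ?_
      obtain ⟨φ, rfl⟩ := (dualEquiv P).surjective e
      change ψ (extDualMap 0 ι (dualEquiv P φ)) -
        evalDual a ((dualEquiv A).symm (extDualMap 0 ι (dualEquiv P φ))) = 0
      rw [extDualMap_dualEquiv, LinearEquiv.symm_apply_apply, hx', sub_eq_zero]
      rfl
    rw [sub_eq_zero] at hψa
    have ha : a = 0 := by
      refine hf' ?_
      rw [map_zero]
      refine hB.isTorsionless _ fun φ => ?_
      have h2 : ψ (extDualMap 0 f (dualEquiv B φ)) = 0 := LinearMap.congr_fun hψ _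
      rw [extDualMap_dualEquiv, hψa, LinearMap.comp_apply, LinearEquiv.coe_coe,
        LinearEquiv.symm_apply_apply] at h2
      exact op_injective h2
    rw [hψa, ha]
    refine LinearMap.ext fun e => ?_
    exact congrArg op (map_zero ((dualEquiv A).symm e))

/-- For `i > 0` the source of `Extⁱ(Extⁱ(f, Λ), Λ)` vanishes: `Extⁱ(A, Λ)` is
`Extⁱ⁺¹⁺ᵏ` of a finitely generated module, so its grade exceeds `i`. -/
theorem IsSmallG.mono_extDualMap_extDualMap {n k : ℕ} [IsNoetherianRing Λ] (h : IsSmallG Λ n k)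
    {A B : ModuleCat.{u} Λ} (f : A ⟶ B) (hA : Omega Λ (k + 1) A) (hB : Omega Λ (k + 1) B)
    (hf : Mono f) (i : ℕ) (hi : i < n) : Mono (extDualMap i (extDualMap i f)) := by
  obtain rfl | hi0 := Nat.eq_zero_or_pos i
  · exact IsSmallG.mono_extDualMap_zero_extDualMap_zero h hi f hA hB hf
  · obtain ⟨A', hA', hA⟩ := hA
    obtain ⟨e⟩ := hA.nonempty_iso hi0
    have h1 := h A' hA' (i + 1) (by lia) (by lia)
    rw [show i + 1 + k = i + (k + 1) by lia] at h1
    have := subsingleton_extDual_of_iso e.symm (le_grade_iff.1 h1 i (by lia))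
    rw [ModuleCat.mono_iff_injective]
    exact Function.injective_of_subsingleton _

/-- Let `D = Ωᵏ⁺ʳ C` with `i = j + 1 + r`, and let `0 → A → P → D → 0` be exact with `P`
projective. The hypothesis on `A → P` kills `Extʲ(Extʲ⁺¹(D, Λ), Λ) ≅ Extʲ(Extⁱ⁺ᵏ(C, Λ), Λ)`. -/
theorem isSmallG_of_mono {n k : ℕ} [IsNoetherianRing Λ]
    (h : ∀ (A B : ModuleCat.{u} Λ) (f : A ⟶ B), Omega Λ (k + 1) A → Omega Λ (k + 1) B → Mono f →
      ∀ i : ℕ, i < n → Mono (extDualMap i (extDualMap i f))) : IsSmallG Λ n k := by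
  intro C hC i hi hin
  refine le_grade_iff.2 fun j hj => ?_
  obtain ⟨r, rfl⟩ := Nat.exists_eq_add_of_lt hj
  obtain ⟨C', hC'⟩ := exists_isSyzygy r C
  have := hC'.finite
  obtain ⟨D, hD⟩ := exists_isSyzygy k C'
  have := hD.finite
  obtain ⟨A, hA⟩ := exists_isSyzygy 1 D
  obtain ⟨P, f, g, _, _, hs⟩ := isSyzygy_one.1 hA
  have hm : Mono (extDualMap j (extDualMap j f)) :=
    h A P f ⟨C', ‹_›, isSyzygy_add.2 ⟨D, hD, hA⟩⟩ (omega_of_projective _ P)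
      ((ModuleCat.mono_iff_injective f).2 hs.injective) j (by lia)
  rw [ModuleCat.mono_iff_injective] at hm
  obtain ⟨e⟩ := (isSyzygy_add.2 ⟨C', hC', hD⟩).nonempty_iso (m := j + 1) (by lia)
  rw [show j + r + 1 + k = j + 1 + (r + k) by lia]
  refine subsingleton_extDual_of_iso e ?_
  obtain rfl | hj0 := Nat.eq_zero_or_pos j
  · refine subsingleton_of_forall_eq 0 fun e => ?_
    obtain ⟨φ, rfl⟩ := (dualEquiv _).surjective e
    have h0 : extDualMap 0 f ≫ connecting hs 0 = 0 := by
      ext e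
      exact (exact_extDualMap_connecting hs 0).apply_apply_eq_zero e
    have h1 : extDualMap 0 (connecting hs 0) (dualEquiv _ φ) = 0 := by
      refine hm ?_
      rw [map_zero, ← ModuleCat.comp_apply, ← extDualMap_comp, h0, extDualMap_zero]
      rfl
    rw [extDualMap_dualEquiv, LinearEquiv.map_eq_zero_iff] at h1
    have h2 : φ = 0 := by
      refine LinearMap.ext fun e => ?_
      obtain ⟨e, rfl⟩ :=
        surjective_connecting hs (subsingleton_extDual_of_projective P le_rfl) e
      exact LinearMap.congr_fun h1 e
    rw [h2, map_zero]
  · obtain ⟨e'⟩ := nonempty_iso_of_vanishing hs (subsingleton_extDual_of_projective P hj0)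
      (subsingleton_extDual_of_projective P (by lia : 1 ≤ j + 1))
    refine subsingleton_extDual_of_iso e' ?_
    have := subsingleton_extDual_of_projective P hj0
    have := subsingleton_extDual_of_subsingleton (extDual j P) j
    exact hm.subsingleton

end GradeCondition

/-! ### Torsionfree syzygies, approximations and the grade condition -/

section Torsionfree

variable {Λ : Type u} [Ring Λ]

/-- For `i = 0` the conclusion is that `Ωᵏ(mod Λ)` consists of torsionless modules. -/
theorem IsSmallG.omega_le [IsNoetherianRing Λ] {n k : ℕ} (hk : 0 < k) (h : IsSmallG Λ n k)
    {i : ℕ} (hin : i ≤ n) : Omega Λ (i + k) ≤ F Λ (i + 1) := by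
  rintro S ⟨C, hC, hS⟩
  refine ⟨hS.finite, fun T hT => ?_⟩
  rw [show i + k = (k - 1) + (i + 1) by lia] at hS
  obtain ⟨D, hD, hS⟩ := isSyzygy_add.1 hS
  refine hS.subsingleton_extDual_transpose (fun j hj => ?_) hT
  obtain rfl | hj0 := Nat.eq_zero_or_pos j
  · exact zero_le
  · obtain ⟨e⟩ := hD.nonempty_iso (m := j + 1) (by lia)
    refine le_grade_of_iso e.symm ?_
    rw [show j + 1 + (k - 1) = j + k by lia]
    exact h C hC j hj0 (by lia)

/-- If `Ωⁱ⁺¹ S` is `(i + 1)`-torsionfree, then `S` has an approximation by a module of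
`𝒲ᵢ₊₁` with kernel in `𝒫ᵢ₊₁`. For `i = 0` the hypothesis is automatic. -/
theorem exists_W_approximation [IsNoetherianRing Λ] [IsNoetherianRing Λᵐᵒᵖ] {i : ℕ}
    {S : ModuleCat.{u} Λ} [Module.Finite Λ S]
    (h : 1 ≤ i → ∀ M, IsSyzygy (i + 1) S M → F Λ (i + 1) M) :
    ∃ (Y X : ModuleCat.{u} Λ) (a : Y ⟶ X) (b : X ⟶ S),
      IsShortExact a b ∧ W Λ (i + 1) X ∧ P Λ (i + 1) Y := by
  obtain ⟨M, hM⟩ := exists_isSyzygy (i + 1) S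
  have := hM.finite
  obtain ⟨T, hT⟩ := exists_isTranspose M
  have hTi : ∀ q, 1 ≤ q → q ≤ i + 1 → Subsingleton (extDual q T) := by
    obtain rfl | hi := Nat.eq_zero_or_pos i
    · refine hM.subsingleton_extDual_transpose (fun j hj => ?_) hT
      obtain rfl : j = 0 := by lia
      exact zero_le
    · exact (h hi M hM).2 T hT
  have hs : IsShortExact (0 : ModuleCat.of Λ PUnit.{u + 1} ⟶ M) (𝟙 M) :=
    isShortExact_iff.2 ⟨Function.injective_of_subsingleton _,
      fun x => ⟨fun hx => ⟨0, hx.symm⟩, fun ⟨_, hx⟩ => hx.symm⟩, Function.surjective_id⟩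
  obtain ⟨Y, X, y, x, hyx, hX, hXv, hY⟩ := exists_approximation (a := 0) hM hs hT hTi
    (fun q h₁ h₂ => absurd h₁ (by lia))
    (ModuleCat.isZero_of_subsingleton _).hasProjectiveDimensionLT_zero
  rw [Nat.zero_add] at hXv hY
  exact ⟨Y, X, y, x, hyx, ⟨hX, lt_rgrade_iff.2 hXv⟩, finite_of_isShortExact hyx,
    projectiveDimension_lt_iff.2 hY⟩

/-- The pullback `Z` of `X → D` and `Q → D`: if `Y` and `S` are the kernels of these epimorphisms,
there are exact sequences `0 → Y → Z → Q → 0` and `0 → S → Z → X → 0`. -/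
theorem exists_pullback_sequence {Y X D S Q : ModuleCat.{u} Λ} {a : Y ⟶ X} {b : X ⟶ D}
    {f : S ⟶ Q} {g : Q ⟶ D} (h₁ : IsShortExact a b) (h₂ : IsShortExact f g) :
    ∃ (Z : Submodule Λ (Q × X)) (a' : Y ⟶ ModuleCat.of Λ Z) (b' : ModuleCat.of Λ Z ⟶ Q)
      (f' : S ⟶ ModuleCat.of Λ Z) (g' : ModuleCat.of Λ Z ⟶ X),
      IsShortExact a' b' ∧ IsShortExact f' g' := by
  let Z := LinearMap.eqLocus (g.hom.comp (LinearMap.fst Λ Q X)) (b.hom.comp (LinearMap.snd Λ Q X))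
  have hZ (z : Z) : g.hom z.1.1 = b.hom z.1.2 := z.2
  let a' : Y →ₗ[Λ] Z := ((LinearMap.inr Λ Q X).comp a.hom).codRestrict Z fun y => by
    change g.hom 0 = b.hom (a.hom y)
    rw [map_zero, h₁.exact.apply_apply_eq_zero]
  let f' : S →ₗ[Λ] Z := ((LinearMap.inl Λ Q X).comp f.hom).codRestrict Z fun s => by
    change g.hom (f.hom s) = b.hom 0
    rw [map_zero, h₂.exact.apply_apply_eq_zero]
  refine ⟨Z, ModuleCat.ofHom a', ModuleCat.ofHom ((LinearMap.fst Λ Q X).comp Z.subtype),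
    ModuleCat.ofHom f', ModuleCat.ofHom ((LinearMap.snd Λ Q X).comp Z.subtype),
    isShortExact_iff.2 ⟨?_, ?_, ?_⟩, isShortExact_iff.2 ⟨?_, ?_, ?_⟩⟩
  · exact fun u v huv => h₁.injective (congrArg (fun z : Z => z.1.2) huv)
  · refine fun z => ⟨fun hz => ?_, ?_⟩
    · have hz : z.1.1 = 0 := hz
      have hb := hZ z
      rw [hz, map_zero] at hb
      obtain ⟨y, hy⟩ := (h₁.exact _).1 hb.symm
      exact ⟨y, Subtype.ext (Prod.ext hz.symm hy)⟩
    · rintro ⟨y, rfl⟩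
      rfl
  · intro q
    obtain ⟨x, hx⟩ := h₁.surjective (g.hom q)
    exact ⟨⟨(q, x), hx.symm⟩, rfl⟩
  · exact fun u v huv => h₂.injective (congrArg (fun z : Z => z.1.1) huv)
  · refine fun z => ⟨fun hz => ?_, ?_⟩
    · have hz : z.1.2 = 0 := hz
      have hb := hZ z
      rw [hz, map_zero] at hb
      obtain ⟨s, hs⟩ := (h₂.exact _).1 hb
      exact ⟨s, Subtype.ext (Prod.ext hs hz.symm)⟩
    · rintro ⟨s, rfl⟩
      rfl
  · intro x
    obtain ⟨q, hq⟩ := h₂.surjective (b.hom x)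
    exact ⟨⟨(q, x), hq⟩, rfl⟩

/-- If `pd Y ≤ i` and `grade Extʲ(Y, Λ) ≥ j` for `1 ≤ j < i`, then also
`grade Extⁱ(Y, Λ) ≥ i`: this module is a transpose of `Ωⁱ⁻¹ Y`, which is
`(i - 1)`-torsionfree. -/
theorem le_grade_extDual_of_hasProjectiveDimensionLT [IsNoetherianRing Λ] {i : ℕ} (hi : 1 ≤ i)
    {Y : ModuleCat.{u} Λ} [Module.Finite Λ Y] (hY : HasProjectiveDimensionLT Y (i + 1))
    (h : ∀ j, 1 ≤ j → j < i → (j : ℕ∞) ≤ grade (extDual j Y)) :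
    (i : ℕ∞) ≤ grade (extDual i Y) := by
  obtain ⟨i, rfl⟩ := Nat.exists_eq_add_of_le' hi
  obtain ⟨Z, hZ⟩ := exists_isSyzygy i Y
  have := hZ.finite
  have hZ2 : HasProjectiveDimensionLT Z 2 := hZ.hasProjectiveDimensionLT (by lia)
    (by rwa [show 2 + i = i + 1 + 1 by lia])
  obtain ⟨Q₁, hQ₁⟩ := exists_isSyzygy 1 Z
  have := hQ₁.finite
  obtain ⟨Q₀, f, g, _, _, hs⟩ := isSyzygy_one.1 hQ₁
  have := hs.hasProjectiveDimensionLT_left (hasProjectiveDimensionLT_of_projective Q₀ le_rfl) hZ2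
  have := projective_of_hasProjectiveDimensionLT Q₁
  have hT : IsTranspose Z (extDual 1 Z) := by
    refine ⟨Q₁, Q₀, f, g, ‹_›, ‹_›, ‹_›, ‹_›, hs.exact, hs.surjective, ?_⟩
    let δ : (Q₁ →ₗ[Λ] Λ) →ₗ[Λᵐᵒᵖ] extDual 1 Z :=
      (connecting hs 0).hom.comp (dualEquiv Q₁).toLinearMap
    have hδ : Function.Surjective δ :=
      (surjective_connecting hs (subsingleton_extDual_of_projective Q₀ le_rfl)).comp
        (dualEquiv Q₁).surjective
    have hker : LinearMap.range (dualMap f.hom) = LinearMap.ker δ := by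
      ext φ
      rw [LinearMap.mem_ker]
      refine Iff.trans ⟨?_, ?_⟩ (exact_extDualMap_connecting hs 0 (dualEquiv Q₁ φ)).symm
      · rintro ⟨χ, rfl⟩
        exact ⟨dualEquiv Q₀ χ, extDualMap_dualEquiv f χ⟩
      · rintro ⟨e, he⟩
        obtain ⟨χ, rfl⟩ := (dualEquiv Q₀).surjective e
        exact ⟨χ, (dualEquiv Q₁).injective ((extDualMap_dualEquiv f χ).symm.trans he)⟩
    exact ⟨((Submodule.quotEquivOfEq _ _ hker).trans (δ.quotKerEquivOfSurjective hδ)).symm⟩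
  obtain ⟨e⟩ := hZ.nonempty_iso (m := 1) le_rfl
  rw [add_comm i 1]
  refine le_grade_of_iso e (le_grade_iff.2 fun q hq => ?_)
  obtain rfl | hq0 := Nat.eq_zero_or_pos q
  ·
    -- A homomorphism `ψ` on `Coker(Q₀* → Q₁*)` is evaluation at a `y ∈ Q₁` that `f` kills.
    refine subsingleton_extDual_zero_iff.2 fun ψ => ?_
    obtain ⟨y, hy⟩ := exists_eq_evalDual Λ
      ((ψ.comp (connecting hs 0).hom).comp (dualEquiv Q₁).toLinearMap)
    have hy' (φ : Q₁ →ₗ[Λ] Λ) : ψ (connecting hs 0 (dualEquiv Q₁ φ)) = op (φ y) :=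
      LinearMap.congr_fun hy φ
    have hy0 : y = 0 := by
      refine hs.injective ?_
      rw [map_zero]
      refine isTorsionless_of_projective Λ Q₀ _ fun φ => ?_
      have h1 := hy' (dualMap f.hom φ)
      rw [← extDualMap_dualEquiv] at h1
      have h2 : connecting hs 0 (extDualMap 0 f (dualEquiv Q₀ φ)) = 0 :=
        (exact_extDualMap_connecting hs 0).apply_apply_eq_zero _
      rw [h2, map_zero] at h1
      exact op_injective h1.symm
    refine LinearMap.ext fun e => ?_
    obtain ⟨e, rfl⟩ := surjective_connecting hs (subsingleton_extDual_of_projective Q₀ le_rfl) e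
    obtain ⟨φ, rfl⟩ := (dualEquiv Q₁).surjective e
    refine (hy' φ).trans ?_
    rw [hy0, map_zero]
    rfl
  · refine hZ.subsingleton_extDual_transpose (fun j hj => ?_) hT q hq0 (by lia)
    exact (Nat.cast_le.2 (Nat.le_succ j)).trans (h (j + 1) (by lia) (by lia))

/-- Embeddings `0 → Ωᵏ C → Y → X → 0` with `X ∈ 𝒲ᵢ₊₁` and `Y ∈ 𝒫ᵢ₊₁` give the grade condition,
by induction on `i`: they identify `Extʲ⁺ᵏ(C, Λ)` with `Extʲ(Y, Λ)` for `1 ≤ j ≤ i`. -/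
theorem isSmallG_of_exists_embedding [IsNoetherianRing Λ] {n k : ℕ}
    (h : ∀ C : ModuleCat.{u} Λ, Module.Finite Λ C → ∀ i : ℕ, i ≤ n →
      ∀ S : ModuleCat.{u} Λ, IsSyzygy k C S →
        ∃ (Y' X' : ModuleCat.{u} Λ) (a : S ⟶ Y') (b : Y' ⟶ X'),
          IsShortExact a b ∧ W Λ (i + 1) X' ∧ P Λ (i + 1) Y') : IsSmallG Λ n k := by
  intro C hC i
  induction i using Nat.strong_induction_on with
  | _ i ih =>
    intro hi hin
    obtain ⟨S, hS⟩ := exists_isSyzygy k C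
    obtain ⟨Y, X, a, b, hs, ⟨-, hX⟩, hY, hYpd⟩ := h C hC i hin S hS
    have hX := lt_rgrade_iff.1 hX
    have hiso (j : ℕ) (hj : 1 ≤ j) (hji : j ≤ i) :
        Nonempty (extDual j Y ≅ extDual (j + k) C) := by
      obtain ⟨e⟩ := hS.nonempty_iso hj
      obtain ⟨e'⟩ := nonempty_iso_of_vanishing_right hs (hX j hj (by lia))
        (hX (j + 1) (by lia) (by lia))
      exact ⟨e' ≪≫ e⟩
    obtain ⟨e⟩ := hiso i hi le_rfl
    refine le_grade_of_iso e (le_grade_extDual_of_hasProjectiveDimensionLT hi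
      (projectiveDimension_lt_iff.1 hYpd) fun j hj hji => ?_)
    obtain ⟨e⟩ := hiso j hj hji.le
    exact le_grade_of_iso e.symm (ih j hji hj (by lia))

end Torsionfree

end AuslanderType

theorem theorem3p4 (Λ : Type u) [Ring Λ] [IsNoetherianRing Λ] [IsNoetherianRing Λᵐᵒᵖ]
    (n k : ℕ) :
    (AuslanderType.IsSmallG Λ n k ↔
      ∀ (A B : ModuleCat.{u} Λ) (f : A ⟶ B),
        AuslanderType.Omega Λ (k + 1) A → AuslanderType.Omega Λ (k + 1) B → Mono f →
          ∀ i : ℕ, i < n → Mono (AuslanderType.extDualMap i (AuslanderType.extDualMap i f))) ∧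
    (0 < k → List.TFAE [
      AuslanderType.IsSmallG Λ n k,
      ∀ (A B : ModuleCat.{u} Λ) (f : A ⟶ B),
        AuslanderType.Omega Λ (k + 1) A → AuslanderType.Omega Λ (k + 1) B → Mono f →
          ∀ i : ℕ, i < n → Mono (AuslanderType.extDualMap i (AuslanderType.extDualMap i f)),
      ∀ i : ℕ, 1 ≤ i → i ≤ n → AuslanderType.Omega Λ (i + k) ≤ AuslanderType.F Λ (i + 1),
      ∀ C : ModuleCat.{u} Λ, Module.Finite Λ C → ∀ i : ℕ, i ≤ n →
        ∀ S : ModuleCat.{u} Λ, AuslanderType.IsSyzygy (k - 1) C S →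
          ∃ (Y X : ModuleCat.{u} Λ) (a : Y ⟶ X) (b : X ⟶ S),
            AuslanderType.IsShortExact a b ∧
              AuslanderType.W Λ (i + 1) X ∧ AuslanderType.P Λ (i + 1) Y,
      ∀ C : ModuleCat.{u} Λ, Module.Finite Λ C → ∀ i : ℕ, i ≤ n →
        ∀ S : ModuleCat.{u} Λ, AuslanderType.IsSyzygy k C S →
          ∃ (Y' X' : ModuleCat.{u} Λ) (a : S ⟶ Y') (b : Y' ⟶ X'),
            AuslanderType.IsShortExact a b ∧
              AuslanderType.W Λ (i + 1) X' ∧ AuslanderType.P Λ (i + 1) Y']) := by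
  have h12 : AuslanderType.IsSmallG Λ n k ↔
      ∀ (A B : ModuleCat.{u} Λ) (f : A ⟶ B),
        AuslanderType.Omega Λ (k + 1) A → AuslanderType.Omega Λ (k + 1) B → Mono f →
          ∀ i : ℕ, i < n → Mono (AuslanderType.extDualMap i (AuslanderType.extDualMap i f)) :=
    ⟨fun h _ _ f hA hB hf i hi => h.mono_extDualMap_extDualMap f hA hB hf i hi,
      AuslanderType.isSmallG_of_mono⟩
  refine ⟨h12, fun hk => ?_⟩
  tfae_have 1 ↔ 2 := h12
  tfae_have 1 → 3 := fun h i _ hin => h.omega_le hk hin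
  tfae_have 3 → 4 := by
    intro h C _ i hin S hS
    have := hS.finite
    refine AuslanderType.exists_W_approximation fun hi M hM => h i hi hin M ⟨C, ‹_›, ?_⟩
    rw [show i + k = (k - 1) + (i + 1) by lia]
    exact AuslanderType.isSyzygy_add.2 ⟨S, hS, hM⟩
  tfae_have 4 → 5 := by
    intro h C hC i hin S hS
    rw [show k = (k - 1) + 1 by lia] at hS
    obtain ⟨D, hD, hS⟩ := AuslanderType.isSyzygy_add.1 hS
    obtain ⟨Q, f, g, _, _, h₂⟩ := AuslanderType.isSyzygy_one.1 hS
    obtain ⟨Y, X, a, b, h₁, hX, hY, hYpd⟩ := h C hC i hin D hD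
    obtain ⟨Z, a', b', f', g', ha, hf⟩ := AuslanderType.exists_pullback_sequence h₁ h₂
    have := hX.1
    refine ⟨ModuleCat.of Λ Z, X, f', g', hf, hX, inferInstanceAs (Module.Finite Λ Z), ?_⟩
    exact projectiveDimension_lt_iff.2 (ha.hasProjectiveDimensionLT_middle
      (projectiveDimension_lt_iff.1 hYpd)
      (AuslanderType.hasProjectiveDimensionLT_of_projective Q (by lia)))
  tfae_have 5 → 1 := AuslanderType.isSmallG_of_exists_embedding
  tfae_finish
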